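/- Let $d\ge 1$, $\mathbb T^d=\mathbb R^d/\mathbb Z^d$, and let $S:\mathbb R^d\times\mathbb R^d\to\mathbb R$ be a $C^2$ function such that $S(x+s,y+s)=S(x,y)$ for all $s\in\mathbb Z^d$, and such that for some $A>0$ $$\sum_{i,j}\frac{\partial^2 S}{\partial x_i\partial y_j}(x,y)\,\xi_i\xi_j\le -A\|\xi\|^2\qquad\text{for all }x,y,\xi\in\mathbb R^d.$$ Let $\bar F$ be the bijection of $T^*\mathbb R^d=\mathbb R^d\times(\mathbb R^d)^*$ defined by $$\bar F(x,p)=(x',p')\iff p=-\partial_1S(x,x')\ \text{ and }\ p'=\partial_2S(x,x'),$$ and let $F$ be the bijection of $T^*\mathbb T^d=\mathbb T^d\times(\mathbb R^d)^*$ whose lift is $\bar F$. Let $\pi:T^*\mathbb T^d\to\mathbb T^d$ be the projection and $V(\omega)=\ker D\pi(\omega)$ the vertical space at $\omega$. Assume that $F$ is without conjugate points, that is, $V(F^n(\omega))\cap DF^n(\omega)V(\omega)=\{0\}$ for all $\omega\in T^*\mathbb T^d$ and all integers $n\ne0$. For an integer $N\ge1$ and $r\in\mathbb Z^d$, let $\Gamma^*_{N,r}\subset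 T^*\mathbb T^d$ be the projection of the set of all $(x,p)\in T^*\mathbb R^d$ with $\bar F^N(x,p)=(x+r,p)$. **Proposition 3.1.** (i) $\Gamma^*_{N,r}$ is a graph over $\mathbb T^d$: for every $\theta\in\mathbb T^d$ there is exactly one $p\in(\mathbb R^d)^*$ with $(\theta,p)\in\Gamma^*_{N,r}$. It is $F$-invariant: $F(\Gamma^*_{N,r})=\Gamma^*_{N,r}$. (ii) $F^N(\omega)=\omega$ for every $\omega\in\Gamma^*_{N,r}$. (iii) $\Gamma^*_{N,r}$ is a Lagrangian submanifold of $T^*\mathbb T^d$ of class $C^1$; more generally it is of class $C^k$ whenever $S$ is of class $C^{k+1}$, $1\le k\le\infty$. For every $\omega\in\Gamma^*_{N,r}$ the limit of subspaces $$G(\omega)=\lim_{n\to+\infty}DF^n\bigl(F^{-n}(\omega)\bigr)\,V\bigl(F^{-n}(\omega)\bigr)$$ (the Green bundle at $\omega$) exists, and $T_\omega\Gamma^*_{N,r}=G(\omega)$. -/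

import Mathlib

open Set Filter Topology
open scoped Manifold

noncomputable section

/-! ### The torus and its cotangent bundle -/

/-- Euclidean space `ℝ^d`. -/
abbrev Euc (d : ℕ) : Type := EuclideanSpace ℝ (Fin d)

/-- The dual space `(ℝ^d)^*`. -/
abbrev EucDual (d : ℕ) : Type := StrongDual ℝ (Euc d)

/-- `T^*ℝ^d = ℝ^d × (ℝ^d)^*`. -/
abbrev CotEuc (d : ℕ) : Type := Euc d × EucDual d

/-- The inclusion `ℤ^d → ℝ^d`. -/
def intVec {d : ℕ} : (Fin d → ℤ) →+ Euc d where
  toFun r := WithLp.toLp 2 fun i => (r i : ℝ)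
  map_zero' := by ext i; simp
  map_add' r s := by ext i; simp

/-- The lattice `ℤ^d ⊆ ℝ^d`. -/
def intLattice (d : ℕ) : AddSubgroup (Euc d) := (intVec (d := d)).range

/-- The torus `𝕋^d = ℝ^d / ℤ^d`, with the quotient topology. -/
abbrev Torus (d : ℕ) : Type := Euc d ⧸ intLattice d

/-- The projection `ℝ^d → 𝕋^d`. -/
def torusMk {d : ℕ} (x : Euc d) : Torus d := (x : Euc d ⧸ intLattice d)

theorem torusMk_eq_iff {d : ℕ} {x y : Euc d} :
    torusMk x = torusMk y ↔ ∃ r : Fin d → ℤ, y = x + intVec r := by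
  unfold torusMk
  rw [QuotientAddGroup.eq]
  constructor
  · rintro ⟨r, hr⟩
    exact ⟨r, by rw [hr]; abel⟩
  · rintro ⟨r, rfl⟩
    exact ⟨r, by abel⟩

theorem torusMk_add {d : ℕ} (x : Euc d) (r : Fin d → ℤ) :
    torusMk (x + intVec r) = torusMk x :=
  (torusMk_eq_iff.2 ⟨r, rfl⟩).symm

theorem torusMk_out {d : ℕ} (θ : Torus d) : torusMk θ.out = θ :=
  Quotient.out_eq' θ

theorem intVec_eq_zero {d : ℕ} {r : Fin d → ℤ} (h : ‖intVec r‖ < 1) : intVec r = 0 := by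
  ext i
  have h1 : ‖(intVec r) i‖ < 1 := (PiLp.norm_apply_le _ i).trans_lt h
  have h2 : ((|r i| : ℤ) : ℝ) < 1 := by
    simpa [intVec, Real.norm_eq_abs] using h1
  have h3 : |r i| < 1 := by exact_mod_cast h2
  have h4 : r i = 0 := Int.abs_lt_one_iff.1 h3
  simp [intVec, h4]

theorem continuous_torusMk {d : ℕ} : Continuous (torusMk (d := d)) :=
  continuous_quotient_mk'

theorem isLocalHomeomorph_torusMk {d : ℕ} : IsLocalHomeomorph (torusMk (d := d)) := by
  rw [isLocalHomeomorph_iff_isOpenEmbedding_restrict]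
  intro x
  refine ⟨Metric.ball x (1 / 2), Metric.ball_mem_nhds x (by norm_num), ?_⟩
  refine IsOpenEmbedding.of_continuous_injective_isOpenMap
    (continuous_torusMk.comp continuous_subtype_val) ?_ ?_
  · rintro ⟨y, hy⟩ ⟨z, hz⟩ h
    obtain ⟨r, hr⟩ := torusMk_eq_iff.1 (show torusMk y = torusMk z from h)
    have h1 : ‖intVec r‖ < 1 := by
      have : intVec r = z - y := by rw [hr]; abel
      rw [this, ← dist_eq_norm]
      rw [Metric.mem_ball] at hy hz
      have := dist_triangle_right z y x
      linarith
    rw [intVec_eq_zero h1, add_zero] at hr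
    exact Subtype.ext hr.symm
  · exact (QuotientAddGroup.isOpenMap_coe (N := intLattice d)).comp
      Metric.isOpen_ball.isOpenMap_subtype_val

/-- The charts of `𝕋^d` are the local inverses of the projection `ℝ^d → 𝕋^d`. -/
instance torusChartedSpace (d : ℕ) : ChartedSpace (Euc d) (Torus d) :=
  isLocalHomeomorph_torusMk.chartedSpaceOfRightInverse (g := Quotient.out) torusMk_out

instance torusIsManifold (d : ℕ) (n : WithTop ℕ∞) : IsManifold 𝓘(ℝ, Euc d) n (Torus d) := by
  apply isManifold_of_contDiffOn
  rintro _ _ ⟨q, rfl⟩ ⟨q', rfl⟩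
  set e := isLocalHomeomorph_torusMk.localInverseAt (q.out : Euc d) with he
  set e' := isLocalHomeomorph_torusMk.localInverseAt (q'.out : Euc d) with he'
  have hs : ((e.trans (chartAt (Euc d) q.out)).symm.trans
      (e'.trans (chartAt (Euc d) q'.out))).source = (e.symm.trans e').source := by
    simp [chartAt_self_eq]
  have hf : ((e.trans (chartAt (Euc d) q.out)).symm.trans
      (e'.trans (chartAt (Euc d) q'.out)) : Euc d → Euc d) = fun x => e' (torusMk x) := by
    ext1 x
    simp [he, chartAt_self_eq]
  intro x hx
  have hx' : x ∈ (e.symm.trans e').source := by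
    rw [← hs]; exact hx.1
  have hcont : ContinuousOn (fun y => e' (torusMk y)) (e.symm.trans e').source := by
    have := (e.symm.trans e').continuousOn
    simpa [he, Function.comp_def] using this
  have hopen := (e.symm.trans e').open_source
  have hint : ∀ y ∈ (e.symm.trans e').source, ∃ r : Fin d → ℤ, e' (torusMk y) = y + intVec r := by
    intro y hy
    refine torusMk_eq_iff.1 ?_
    have : torusMk y ∈ e'.source := by
      have := hy
      simp only [OpenPartialHomeomorph.trans_source, mem_inter_iff, mem_preimage] at this
      simpa [he] using this.2
    exact (isLocalHomeomorph_torusMk.apply_localInverseAt_of_mem this).symm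
  have hev : (fun y => e' (torusMk y)) =ᶠ[𝓝 x] fun y => y + (e' (torusMk x) - x) := by
    have hc : ContinuousAt (fun y => (e' (torusMk y) - y) - (e' (torusMk x) - x)) x :=
      ((hcont.continuousAt (hopen.mem_nhds hx')).sub continuousAt_id).sub continuousAt_const
    have h1 : ∀ᶠ y in 𝓝 x, ‖(e' (torusMk y) - y) - (e' (torusMk x) - x)‖ < 1 := by
      have := hc.norm.eventually_lt (continuousAt_const (y := (1 : ℝ))) (by simp)
      exact this
    filter_upwards [h1, hopen.mem_nhds hx'] with y hy hys
    obtain ⟨r, hr⟩ := hint y hys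
    obtain ⟨s, hs⟩ := hint x hx'
    have h2 : (e' (torusMk y) - y) - (e' (torusMk x) - x) = intVec (r - s) := by
      rw [hr, hs, map_sub]; abel
    rw [h2] at hy
    rw [intVec_eq_zero hy] at h2
    rw [sub_eq_zero] at h2
    rw [← h2]; abel
  have hcd : ContDiffAt ℝ n (fun y => e' (torusMk y)) x :=
    ContDiffAt.congr_of_eventuallyEq (contDiffAt_id.add contDiffAt_const) hev
  have : ContDiffWithinAt ℝ n ((e.trans (chartAt (Euc d) q.out)).symm.trans
      (e'.trans (chartAt (Euc d) q'.out)) : Euc d → Euc d)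
      (𝓘(ℝ, Euc d).symm ⁻¹' ((e.trans (chartAt (Euc d) q.out)).symm.trans
      (e'.trans (chartAt (Euc d) q'.out))).source ∩ range 𝓘(ℝ, Euc d)) x := by
    rw [hf]; exact hcd.contDiffWithinAt
  exact this

/-- `T^*𝕋^d`, identified with `𝕋^d × (ℝ^d)^*` by means of the global frame `dx_1, …, dx_d`. -/
abbrev CotTorus (d : ℕ) : Type := Torus d × EucDual d

/-- The model with corners of `T^*𝕋^d`. -/
abbrev cotModel (d : ℕ) := 𝓘(ℝ, Euc d).prod 𝓘(ℝ, EucDual d)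

/-- The projection `T^*ℝ^d → T^*𝕋^d`. -/
def cotMk {d : ℕ} (z : CotEuc d) : CotTorus d := (torusMk z.1, z.2)

/-- The canonical projection `π : T^*𝕋^d → 𝕋^d`. -/
def cotProj {d : ℕ} (ω : CotTorus d) : Torus d := ω.1

/-- The vertical space `V(ω) = Ker Dπ(ω)`. Every tangent space `T_ω T^*𝕋^d` is identified with
`ℝ^d × (ℝ^d)^*` by means of the coordinates `(x, p)`: in Mathlib this is the very definition of
`TangentSpace`, and the preferred charts are the local coordinates `(x, p)`. -/
def verticalSpace {d : ℕ} (ω : CotTorus d) : Submodule ℝ (CotEuc d) :=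
  LinearMap.ker (mfderiv (cotModel d) 𝓘(ℝ, Euc d) cotProj ω : CotEuc d →L[ℝ] Euc d).toLinearMap

/-- The differential `DG(ω) : T_ω T^*𝕋^d → T_{G(ω)} T^*𝕋^d`. -/
def cotDeriv {d : ℕ} (G : CotTorus d → CotTorus d) (ω : CotTorus d) : CotEuc d →L[ℝ] CotEuc d :=
  mfderiv (cotModel d) (cotModel d) G ω

/-- The canonical symplectic form `∑ dp_i ∧ dx_i` on each tangent space of `T^*𝕋^d`. -/
def canonicalForm {d : ℕ} (v w : CotEuc d) : ℝ := v.2 w.1 - w.2 v.1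

/-! ### Generating functions and twist maps -/

/-- The partial differential `∂₁S(x, y) ∈ (ℝ^d)^*`. -/
def partialFst {d : ℕ} (S : Euc d × Euc d → ℝ) (x y : Euc d) : EucDual d :=
  fderiv ℝ (fun x' => S (x', y)) x

/-- The partial differential `∂₂S(x, y) ∈ (ℝ^d)^*`. -/
def partialSnd {d : ℕ} (S : Euc d × Euc d → ℝ) (x y : Euc d) : EucDual d :=
  fderiv ℝ (fun y' => S (x, y')) y

/-- A generating function: a `C²` function `S` on `ℝ^d × ℝ^d`, invariant under the diagonal action
of `ℤ^d`, that satisfies the uniform twist condition. -/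
structure GeneratingFunction (d : ℕ) where
  /-- the function -/
  S : Euc d × Euc d → ℝ
  contDiff : ContDiff ℝ 2 S
  periodic : ∀ (r : Fin d → ℤ) (x y : Euc d), S (x + intVec r, y + intVec r) = S (x, y)
  /-- `∑ ∂²S/∂x_i∂y_j (x, y) ξ_i ξ_j ≤ -A ‖ξ‖²` -/
  twist : ∃ A : ℝ, 0 < A ∧ ∀ x y ξ : Euc d,
    fderiv ℝ (fun y' => partialFst S x y' ξ) y ξ ≤ -A * ‖ξ‖ ^ 2

theorem bijective_of_uniform_twist {d : ℕ} {g : Euc d → EucDual d} (hg : ContDiff ℝ 1 g)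
    {A : ℝ} (hA : 0 < A) (h : ∀ y ξ, fderiv ℝ g y ξ ξ ≤ -A * ‖ξ‖ ^ 2) :
    Function.Bijective g := by
  have hdiff : ∀ y, HasFDerivAt g (fderiv ℝ g y) y := fun y =>
    (hg.differentiable (by norm_num) y).hasFDerivAt
  have hmono : ∀ y z, (g z - g y) (z - y) ≤ -A * ‖z - y‖ ^ 2 := by
    intro y z
    have hd : ∀ t : ℝ, HasDerivAt (fun t : ℝ => g (y + t • (z - y)) (z - y))
        (fderiv ℝ g (y + t • (z - y)) (z - y) (z - y)) t := by
      intro t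
      have h1 : HasDerivAt (fun t : ℝ => y + t • (z - y)) (z - y) t := by
        simpa using ((hasDerivAt_id t).smul_const (z - y)).const_add y
      have h2 := (hdiff (y + t • (z - y))).comp_hasDerivAt t h1
      exact ((ContinuousLinearMap.apply ℝ ℝ (z - y)).hasFDerivAt).comp_hasDerivAt t h2
    obtain ⟨c, -, hc⟩ := exists_hasDerivAt_eq_slope _ _ (zero_lt_one (α := ℝ))
      (fun t _ => (hd t).continuousAt.continuousWithinAt) (fun t _ => hd t)
    have := h (y + c • (z - y)) (z - y)
    rw [hc] at this
    simpa using this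
  have hanti : ∀ y z, A * ‖z - y‖ ≤ ‖g z - g y‖ := by
    intro y z
    rcases eq_or_lt_of_le (norm_nonneg (z - y)) with h0 | h0
    · rw [← h0]; simp
    · have h1 := hmono y z
      have h2 := (g z - g y).le_opNorm (z - y)
      have h3 := neg_le_abs ((g z - g y) (z - y))
      rw [Real.norm_eq_abs] at h2
      have : A * ‖z - y‖ * ‖z - y‖ ≤ ‖g z - g y‖ * ‖z - y‖ := by nlinarith
      exact le_of_mul_le_mul_right this h0
  have hAL : AntilipschitzWith (Real.toNNReal A⁻¹) g := by
    refine AntilipschitzWith.of_le_mul_dist fun y z => ?_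
    rw [Real.coe_toNNReal _ (by positivity), dist_eq_norm, dist_eq_norm, inv_mul_eq_div,
      le_div_iff₀ hA, mul_comm]
    exact hanti z y
  refine ⟨hAL.injective, ?_⟩
  have hclosed : IsClosed (range g) := by
    have hp : IsProperMap g := by
      rw [isProperMap_iff_tendsto_cocompact]
      refine ⟨hg.continuous, ?_⟩
      rw [← Metric.cobounded_eq_cocompact, ← Metric.cobounded_eq_cocompact]
      exact hAL.tendsto_cobounded
    exact hp.isClosedMap.isClosed_range
  have hopen : IsOpen (range g) := by
    rw [isOpen_iff_mem_nhds]
    rintro _ ⟨y, rfl⟩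
    have hinj : Function.Injective (fderiv ℝ g y) := by
      rw [injective_iff_map_eq_zero]
      intro ξ hξ
      have := h y ξ
      rw [hξ] at this
      have h0 : ‖ξ‖ ^ 2 ≤ 0 := by
        have : (0 : ℝ) ≤ -A * ‖ξ‖ ^ 2 := by simpa using this
        nlinarith
      exact norm_eq_zero.1 (pow_eq_zero_iff (two_ne_zero) |>.1 (le_antisymm h0 (sq_nonneg _)))
    have hrank : Module.finrank ℝ (Euc d) = Module.finrank ℝ (EucDual d) :=
      (InnerProductSpace.toDual ℝ (Euc d)).toLinearEquiv.finrank_eq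
    have hsurj : Function.Surjective (fderiv ℝ g y).toLinearMap :=
      (LinearMap.injective_iff_surjective_of_finrank_eq_finrank hrank).1 hinj
    have hstrict : HasStrictFDerivAt g (fderiv ℝ g y) y :=
      hg.contDiffAt.hasStrictFDerivAt (by norm_num)
    rw [← hstrict.map_nhds_eq_of_surj (LinearMap.range_eq_top.2 hsurj)]
    exact image_univ (f := g) ▸ image_mem_map univ_mem
  exact range_eq_univ.1 (IsClopen.eq_univ ⟨hclosed, hopen⟩ (range_nonempty g))

namespace GeneratingFunction

variable {d : ℕ} (Φ : GeneratingFunction d)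

theorem hasFDerivAt (z : Euc d × Euc d) : HasFDerivAt Φ.S (fderiv ℝ Φ.S z) z :=
  (Φ.contDiff.differentiable (by norm_num) z).hasFDerivAt

theorem partialFst_eq (x y : Euc d) : partialFst Φ.S x y =
    (fderiv ℝ Φ.S (x, y)).comp (ContinuousLinearMap.inl ℝ (Euc d) (Euc d)) :=
  (HasFDerivAt.comp (f := fun x' => (x', y)) x (Φ.hasFDerivAt (x, y))
    (hasFDerivAt_prodMk_left x y)).fderiv

theorem partialSnd_eq (x y : Euc d) : partialSnd Φ.S x y =
    (fderiv ℝ Φ.S (x, y)).comp (ContinuousLinearMap.inr ℝ (Euc d) (Euc d)) :=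
  (HasFDerivAt.comp (f := fun y' => (x, y')) y (Φ.hasFDerivAt (x, y))
    (hasFDerivAt_prodMk_right x y)).fderiv

theorem contDiff_fderiv : ContDiff ℝ 1 (fderiv ℝ Φ.S) :=
  Φ.contDiff.fderiv_right (by norm_num)

theorem contDiff_partialFst (x : Euc d) : ContDiff ℝ 1 fun y => partialFst Φ.S x y := by
  simp_rw [partialFst_eq]
  exact (Φ.contDiff_fderiv.comp (contDiff_const.prodMk contDiff_id)).clm_comp contDiff_const

theorem contDiff_partialSnd (y : Euc d) : ContDiff ℝ 1 fun x => partialSnd Φ.S x y := by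
  simp_rw [partialSnd_eq]
  exact (Φ.contDiff_fderiv.comp (contDiff_id.prodMk contDiff_const)).clm_comp contDiff_const

theorem hasFDerivAt_fderiv (z : Euc d × Euc d) :
    HasFDerivAt (fderiv ℝ Φ.S) (fderiv ℝ (fderiv ℝ Φ.S) z) z :=
  (Φ.contDiff_fderiv.differentiable (by norm_num) z).hasFDerivAt

theorem fderiv_partialFst_apply (x y ξ : Euc d) :
    fderiv ℝ (fun y' => partialFst Φ.S x y' ξ) y ξ =
      fderiv ℝ (fderiv ℝ Φ.S) (x, y) (0, ξ) (ξ, 0) := by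
  have h1 := (Φ.hasFDerivAt_fderiv (x, y)).comp y (hasFDerivAt_prodMk_right x y)
  have h2 := ((ContinuousLinearMap.apply ℝ ℝ ((ξ, 0) : Euc d × Euc d)).hasFDerivAt).comp y h1
  have h3 : (fun y' => partialFst Φ.S x y' ξ) =
      (ContinuousLinearMap.apply ℝ ℝ ((ξ, 0) : Euc d × Euc d)) ∘
        (fderiv ℝ Φ.S ∘ fun y' => (x, y')) := by
    ext y'
    simp [partialFst_eq]
  rw [h3, h2.fderiv]
  simp

theorem fderiv_partialSnd_apply (x y ξ : Euc d) :
    fderiv ℝ (fun x' => partialSnd Φ.S x' y ξ) x ξ =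
      fderiv ℝ (fderiv ℝ Φ.S) (x, y) (ξ, 0) (0, ξ) := by
  have h1 := HasFDerivAt.comp (f := fun x' => (x', y)) x (Φ.hasFDerivAt_fderiv (x, y))
    (hasFDerivAt_prodMk_left x y)
  have h2 := ((ContinuousLinearMap.apply ℝ ℝ ((0, ξ) : Euc d × Euc d)).hasFDerivAt).comp x h1
  have h3 : (fun x' => partialSnd Φ.S x' y ξ) =
      (ContinuousLinearMap.apply ℝ ℝ ((0, ξ) : Euc d × Euc d)) ∘
        (fderiv ℝ Φ.S ∘ fun x' => (x', y)) := by
    ext x'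
    simp [partialSnd_eq]
  rw [h3, h2.fderiv]
  simp

theorem fderiv_apply_self {g : Euc d → EucDual d} (hg : ContDiff ℝ 1 g) (y ξ : Euc d) :
    fderiv ℝ (fun y' => g y' ξ) y ξ = fderiv ℝ g y ξ ξ := by
  have h1 := (hg.differentiable (by norm_num) y).hasFDerivAt
  have h2 := ((ContinuousLinearMap.apply ℝ ℝ ξ).hasFDerivAt).comp y h1
  have h3 : (fun y' => g y' ξ) = ContinuousLinearMap.apply ℝ ℝ ξ ∘ g := rfl
  rw [h3, h2.fderiv]
  rfl

/-- For every `x`, the map `y ↦ ∂₁S(x, y)` is a bijection. -/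
theorem bijective_partialFst (x : Euc d) : Function.Bijective fun y => partialFst Φ.S x y := by
  obtain ⟨A, hA, h⟩ := Φ.twist
  refine bijective_of_uniform_twist (Φ.contDiff_partialFst x) hA fun y ξ => ?_
  rw [← fderiv_apply_self (Φ.contDiff_partialFst x)]
  exact h x y ξ

/-- For every `y`, the map `x ↦ ∂₂S(x, y)` is a bijection. -/
theorem bijective_partialSnd (y : Euc d) : Function.Bijective fun x => partialSnd Φ.S x y := by
  obtain ⟨A, hA, h⟩ := Φ.twist
  refine bijective_of_uniform_twist (Φ.contDiff_partialSnd y) hA fun x ξ => ?_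
  rw [← fderiv_apply_self (Φ.contDiff_partialSnd y)]
  have hsymm : IsSymmSndFDerivAt ℝ Φ.S (x, y) :=
    Φ.contDiff.contDiffAt.isSymmSndFDerivAt (by simp)
  rw [fderiv_partialSnd_apply, hsymm, ← fderiv_partialFst_apply]
  exact h x y ξ

/-- The twist map `F̄ : T^*ℝ^d → T^*ℝ^d`, determined by
`F̄(x, p) = (x', p') ↔ p = -∂₁S(x, x') ∧ p' = ∂₂S(x, x')` (see `lift_eq_iff`). -/
def lift : Equiv.Perm (CotEuc d) where
  toFun z :=
    let x' := (Equiv.ofBijective _ (Φ.bijective_partialFst z.1)).symm (-z.2)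
    (x', partialSnd Φ.S z.1 x')
  invFun z :=
    let x := (Equiv.ofBijective _ (Φ.bijective_partialSnd z.1)).symm z.2
    (x, -partialFst Φ.S x z.1)
  left_inv := by
    rintro ⟨x, p⟩
    have h := (Equiv.ofBijective _ (Φ.bijective_partialFst x)).apply_symm_apply (-p)
    have h' := (Equiv.ofBijective _ (Φ.bijective_partialSnd
      ((Equiv.ofBijective _ (Φ.bijective_partialFst x)).symm (-p)))).symm_apply_apply x
    simp only [Equiv.ofBijective_apply] at h h'
    simp only [h', h, neg_neg]
  right_inv := by
    rintro ⟨x, p⟩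
    have h := (Equiv.ofBijective _ (Φ.bijective_partialSnd x)).apply_symm_apply p
    have h' := (Equiv.ofBijective _ (Φ.bijective_partialFst
      ((Equiv.ofBijective _ (Φ.bijective_partialSnd x)).symm p))).symm_apply_apply x
    simp only [Equiv.ofBijective_apply] at h h'
    simp only [h', h, neg_neg]

theorem lift_eq_iff (x p x' p') : Φ.lift (x, p) = (x', p') ↔
    p = -partialFst Φ.S x x' ∧ p' = partialSnd Φ.S x x' := by
  have h := (Equiv.ofBijective _ (Φ.bijective_partialFst x)).apply_symm_apply (-p)
  have h' := (Equiv.ofBijective _ (Φ.bijective_partialFst x)).symm_apply_apply x'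
  simp only [Equiv.ofBijective_apply] at h h'
  simp only [lift, Equiv.coe_fn_mk, Prod.mk.injEq]
  constructor
  · rintro ⟨rfl, rfl⟩
    exact ⟨by rw [h, neg_neg], rfl⟩
  · rintro ⟨rfl, rfl⟩
    rw [neg_neg, h']
    exact ⟨rfl, rfl⟩

theorem partialFst_add (r : Fin d → ℤ) (x y : Euc d) :
    partialFst Φ.S (x + intVec r) (y + intVec r) = partialFst Φ.S x y := by
  unfold partialFst
  rw [← fderiv_comp_add_right]
  simp_rw [Φ.periodic]

theorem partialSnd_add (r : Fin d → ℤ) (x y : Euc d) :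
    partialSnd Φ.S (x + intVec r) (y + intVec r) = partialSnd Φ.S x y := by
  unfold partialSnd
  rw [← fderiv_comp_add_right]
  simp_rw [Φ.periodic]

theorem lift_add (r : Fin d → ℤ) (x : Euc d) (p : EucDual d) :
    Φ.lift (x + intVec r, p) = ((Φ.lift (x, p)).1 + intVec r, (Φ.lift (x, p)).2) := by
  rw [lift_eq_iff, partialFst_add, partialSnd_add]
  exact (Φ.lift_eq_iff x p _ _).1 rfl

theorem cotMk_lift_eq {z z' : CotEuc d} (h : cotMk z = cotMk z') :
    cotMk (Φ.lift z) = cotMk (Φ.lift z') := by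
  obtain ⟨x, p⟩ := z
  obtain ⟨x', p'⟩ := z'
  simp only [cotMk, Prod.mk.injEq] at h
  obtain ⟨h, rfl⟩ := h
  obtain ⟨r, rfl⟩ := torusMk_eq_iff.1 h
  rw [lift_add]
  simp [cotMk, torusMk_add]

theorem cotMk_lift_symm_eq {z z' : CotEuc d} (h : cotMk z = cotMk z') :
    cotMk (Φ.lift.symm z) = cotMk (Φ.lift.symm z') := by
  obtain ⟨x, p⟩ := z
  obtain ⟨x', p'⟩ := z'
  simp only [cotMk, Prod.mk.injEq] at h
  obtain ⟨h, rfl⟩ := h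
  obtain ⟨r, rfl⟩ := torusMk_eq_iff.1 h
  have h2 : Φ.lift.symm (x + intVec r, p) =
      ((Φ.lift.symm (x, p)).1 + intVec r, (Φ.lift.symm (x, p)).2) := by
    rw [Equiv.symm_apply_eq, lift_add]
    simp
  rw [h2]
  simp [cotMk, torusMk_add]

theorem cotMk_out (ω : CotTorus d) : cotMk (ω.1.out, ω.2) = ω :=
  Prod.ext (torusMk_out ω.1) rfl

/-- The diffeomorphism `F` of `T^*𝕋^d` whose lift to `T^*ℝ^d` is `F̄` (see `map_cotMk`). -/
def map : Equiv.Perm (CotTorus d) where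
  toFun ω := cotMk (Φ.lift (ω.1.out, ω.2))
  invFun ω := cotMk (Φ.lift.symm (ω.1.out, ω.2))
  left_inv ω := by
    beta_reduce
    rw [Φ.cotMk_lift_symm_eq (cotMk_out _), Equiv.symm_apply_apply, cotMk_out]
  right_inv ω := by
    beta_reduce
    rw [Φ.cotMk_lift_eq (cotMk_out _), Equiv.apply_symm_apply, cotMk_out]

theorem map_cotMk (z : CotEuc d) : Φ.map (cotMk z) = cotMk (Φ.lift z) :=
  Φ.cotMk_lift_eq (cotMk_out _)

/-- `F` is without conjugate points: `V(F^n ω) ∩ DF^n(ω) V(ω) = {0}` for all `ω` and all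
integers `n ≠ 0`. -/
def WithoutConjugatePoints : Prop :=
  ∀ (ω : CotTorus d) (n : ℤ), n ≠ 0 →
    verticalSpace ((Φ.map ^ n) ω) ⊓
      (verticalSpace ω).map (cotDeriv (Φ.map ^ n : Equiv.Perm (CotTorus d)) ω).toLinearMap = ⊥

/-- The set of all `(x, p) ∈ T^*ℝ^d` with `F̄^N(x, p) = (x + r, p)`. -/
def liftedPeriodicSet (N : ℕ) (r : Fin d → ℤ) : Set (CotEuc d) :=
  {z | (Φ.lift ^ N) z = (z.1 + intVec r, z.2)}

/-- The set `Γ*_{N,r}`: the projection of `liftedPeriodicSet` to `T^*𝕋^d`. -/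
def periodicSet (N : ℕ) (r : Fin d → ℤ) : Set (CotTorus d) :=
  cotMk '' Φ.liftedPeriodicSet N r

end GeneratingFunction

/-! ### Lagrangian submanifolds and the Green bundle -/

/-- `L` is a (locally closed, embedded) submanifold of `T^*𝕋^d`, of class `C^k` and dimension `m`:
around each of its points there is a `C^k` chart of `T^*𝕋^d` in which `L` is an `m`-dimensional
linear slice. -/
def IsSubmanifold {d : ℕ} (k : WithTop ℕ∞) (m : ℕ) (L : Set (CotTorus d)) : Prop :=
  ∀ ω ∈ L, ∃ e ∈ IsManifold.maximalAtlas (cotModel d) k (CotTorus d), ω ∈ e.source ∧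
    ∃ K : Submodule ℝ (CotEuc d), Module.finrank ℝ K = m ∧
      ∀ η ∈ e.source, η ∈ L ↔ (e η : CotEuc d) ∈ K

/-- The tangent vectors of `L` at `ω`: the velocities at time `0` of the curves in `L` through
`ω`. -/
def tangentVectors {d : ℕ} (L : Set (CotTorus d)) (ω : CotTorus d) : Set (CotEuc d) :=
  {v | ∃ γ : ℝ → CotTorus d, (∀ t, γ t ∈ L) ∧ γ 0 = ω ∧
    HasMFDerivAt 𝓘(ℝ, ℝ) (cotModel d) γ 0 (ContinuousLinearMap.toSpanSingleton ℝ v)}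

/-- `L` is a Lagrangian submanifold of `T^*𝕋^d` of class `C^k`: a submanifold of dimension `d` on
which the canonical symplectic form vanishes. -/
def IsLagrangianSubmanifold {d : ℕ} (k : WithTop ℕ∞) (L : Set (CotTorus d)) : Prop :=
  IsSubmanifold k d L ∧
    ∀ ω ∈ L, ∀ v ∈ tangentVectors L ω, ∀ w ∈ tangentVectors L ω, canonicalForm v w = 0

/-- Convergence in the Grassmannian of a finite-dimensional real vector space `M`: the `V n`
with `n` large and `W` have bases for which the basis of `V n` converges to that of `W`. -/
def SubspaceTendsto {M : Type*} [AddCommGroup M] [Module ℝ M] [TopologicalSpace M]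
    (V : ℕ → Submodule ℝ M) (W : Submodule ℝ M) : Prop :=
  ∃ (m : ℕ) (b : ℕ → Fin m → M) (c : Fin m → M),
    (∀ᶠ n in atTop, LinearIndependent ℝ (b n) ∧ Submodule.span ℝ (range (b n)) = V n) ∧
    (LinearIndependent ℝ c ∧ Submodule.span ℝ (range c) = W) ∧
    ∀ i, Tendsto (fun n => b n i) atTop (𝓝 (c i))

/-- `G` is the fibre `G(ω) = lim_{n → +∞} DF^n(F^{-n} ω) V(F^{-n} ω)` of the (positive) Green
bundle; in particular this limit exists. -/
def IsGreenFibre {d : ℕ} (F : Equiv.Perm (CotTorus d)) (ω : CotTorus d)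
    (G : Submodule ℝ (CotEuc d)) : Prop :=
  SubspaceTendsto (fun n : ℕ =>
    (verticalSpace ((F ^ (-(n : ℤ))) ω)).map
      (cotDeriv (F ^ n : Equiv.Perm (CotTorus d)) ((F ^ (-(n : ℤ))) ω)).toLinearMap) G

end

noncomputable section

/-! ### Functions all of whose critical points are nondegenerate minima -/

section GradientDescent

variable {E : Type*} [NormedAddCommGroup E] [InnerProductSpace ℝ E]

/-- A map whose derivative at a fixed point strictly contracts attracts a neighbourhood. -/
theorem eventually_tendsto_iterate_of_contracting {g : E → E} {g' : E →L[ℝ] E} {m : E} {q : ℝ}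
    (hm : g m = m) (hg : HasFDerivAt g g' m) (hq : q < 1) (hg' : ∀ v, ‖g' v‖ ≤ q * ‖v‖) :
    ∃ r > 0, ∀ y ∈ Metric.ball m r, Tendsto (fun n => g^[n] y) atTop (𝓝 m) := by
  obtain ⟨s, hs, hs1⟩ : ∃ s, max q 0 < s ∧ s < 1 := exists_between (max_lt hq one_pos)
  have hqs : q < s := (le_max_left _ _).trans_lt hs
  have hs0 : 0 < s := (le_max_right _ _).trans_lt hs
  have h1 := hg.isLittleO.def (sub_pos.2 hqs)
  obtain ⟨r, hr, hball⟩ := Metric.eventually_nhds_iff_ball.1 h1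
  have hstep : ∀ y ∈ Metric.ball m r, ‖g y - m‖ ≤ s * ‖y - m‖ := by
    intro y hy
    have h2 := hball y hy
    rw [hm] at h2
    have h3 : g y - m = (g y - m - g' (y - m)) + g' (y - m) := by abel
    calc ‖g y - m‖ ≤ ‖g y - m - g' (y - m)‖ + ‖g' (y - m)‖ := by
          conv_lhs => rw [h3]
          exact norm_add_le _ _
      _ ≤ (s - q) * ‖y - m‖ + q * ‖y - m‖ := add_le_add h2 (hg' _)
      _ = s * ‖y - m‖ := by ring
  refine ⟨r, hr, fun y hy => ?_⟩
  have key : ∀ n, g^[n] y ∈ Metric.ball m r ∧ ‖g^[n] y - m‖ ≤ s ^ n * ‖y - m‖ := by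
    intro n
    induction n with
    | zero => exact ⟨hy, by simp⟩
    | succ n ih =>
      rw [Function.iterate_succ_apply']
      have h4 := hstep _ ih.1
      have h5 : ‖g (g^[n] y) - m‖ ≤ ‖g^[n] y - m‖ :=
        h4.trans (mul_le_of_le_one_left (norm_nonneg _) hs1.le)
      refine ⟨?_, ?_⟩
      · rw [Metric.mem_ball, dist_eq_norm]
        have := ih.1
        rw [Metric.mem_ball, dist_eq_norm] at this
        exact h5.trans_lt this
      · calc _ ≤ s * ‖g^[n] y - m‖ := h4
          _ ≤ s * (s ^ n * ‖y - m‖) := by gcongr; exact ih.2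
          _ = _ := by ring
  rw [tendsto_iff_norm_sub_tendsto_zero]
  refine squeeze_zero (fun _ => norm_nonneg _) (fun n => (key n).2) ?_
  simpa using (tendsto_pow_atTop_nhds_zero_of_lt_one hs0.le hs1).mul_const ‖y - m‖

/-- A gradient step of length `η ≤ 1 / (2 L)` decreases the function. -/
theorem gradient_step_le {f : E → ℝ} (hf : ContDiff ℝ 2 f) {G : E → E}
    (hG : ∀ x v, inner ℝ (G x) v = fderiv ℝ f x v) {x : E} {η L : ℝ} (hη : 0 < η)
    (hL : ∀ t ∈ Icc (0 : ℝ) 1, ‖G (x - (t * η) • G x) - G x‖ ≤ L * ‖(t * η) • G x‖)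
    (hηL : η * L ≤ 1 / 2) (hL0 : 0 ≤ L) :
    f (x - η • G x) ≤ f x - η / 2 * ‖G x‖ ^ 2 := by
  have hd : ∀ t : ℝ, HasDerivAt (fun t : ℝ => f (x - (t * η) • G x))
      (fderiv ℝ f (x - (t * η) • G x) (-(η • G x))) t := by
    intro t
    have h1 : HasDerivAt (fun t : ℝ => x - (t * η) • G x) (-(η • G x)) t := by
      simpa using (((hasDerivAt_id t).mul_const η).smul_const (G x)).const_sub x
    exact (hf.differentiable (by norm_num) _).hasFDerivAt.comp_hasDerivAt t h1
  obtain ⟨c, hc, hc'⟩ := exists_hasDerivAt_eq_slope _ _ (zero_lt_one (α := ℝ))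
    (fun t _ => (hd t).continuousAt.continuousWithinAt) (fun t _ => hd t)
  simp only [one_mul, zero_mul, zero_smul, sub_zero, div_one] at hc'
  have h2 := hL c ⟨hc.1.le, hc.2.le⟩
  set y := x - (c * η) • G x
  have h3 : fderiv ℝ f y (-(η • G x)) = -η * ‖G x‖ ^ 2 - η * inner ℝ (G y - G x) (G x) := by
    rw [← hG, inner_sub_left, inner_neg_right, inner_smul_right, real_inner_self_eq_norm_sq]
    ring
  have h4 : ‖(c * η) • G x‖ ≤ η * ‖G x‖ := by
    rw [norm_smul, Real.norm_eq_abs, abs_of_pos (mul_pos hc.1 hη)]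
    have := hc.2.le
    gcongr
    nlinarith
  have h5 : |inner ℝ (G y - G x) (G x)| ≤ L * (η * ‖G x‖) * ‖G x‖ := by
    refine (abs_real_inner_le_norm _ _).trans ?_
    gcongr
    exact h2.trans (by gcongr)
  have h6 := neg_le_of_abs_le h5
  rw [h3] at hc'
  have h7 : 0 ≤ η * ‖G x‖ ^ 2 := by positivity
  nlinarith [mul_le_mul_of_nonneg_left h6 hη.le, mul_le_mul_of_nonneg_right hηL h7]

variable [FiniteDimensional ℝ E]

/-- The gradient as a `C¹` map, characterised by its inner products. -/
theorem exists_gradient {f : E → ℝ} (hf : ContDiff ℝ 2 f) :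
    ∃ G : E → E, ∃ G' : E → E →L[ℝ] E, (∀ x, HasFDerivAt G (G' x) x) ∧
      (∀ x v, inner ℝ (G x) v = fderiv ℝ f x v) ∧
      (∀ x v w, inner ℝ (G' x v) w = fderiv ℝ (fderiv ℝ f) x v w) := by
  let e := (InnerProductSpace.toDual ℝ E).symm.toContinuousLinearEquiv.toContinuousLinearMap
  have hd : Differentiable ℝ (fderiv ℝ f) :=
    (hf.fderiv_right (m := 1) (by norm_num)).differentiable (by norm_num)
  refine ⟨fun x => e (fderiv ℝ f x), fun x => e.comp (fderiv ℝ (fderiv ℝ f) x), fun x =>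
    e.hasFDerivAt.comp x (hd x).hasFDerivAt, fun x v => ?_, fun x v w => ?_⟩
  · simp [e]
  · simp [e]

theorem exists_uniform_gradient_step {f : E → ℝ} (hf : ContDiff ℝ 2 f) {G : E → E}
    {G' : E → E →L[ℝ] E} (hG : ∀ x, HasFDerivAt G (G' x) x)
    (hGf : ∀ x v, inner ℝ (G x) v = fderiv ℝ f x v)
    (hG' : ∀ x v w, inner ℝ (G' x v) w = fderiv ℝ (fderiv ℝ f) x v w)
    (hpos : ∀ m, G m = 0 → ∀ v ≠ 0, 0 < fderiv ℝ (fderiv ℝ f) m v v)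
    {K : Set E} (hK : IsCompact K) :
    ∃ η > 0, (∀ x ∈ K, f (x - η • G x) ≤ f x - η / 2 * ‖G x‖ ^ 2) ∧
      ∀ m ∈ K, G m = 0 → ∃ q < 1, ∀ v, ‖v - η • G' m v‖ ≤ q * ‖v‖ := by
  have hGc : Continuous G := continuous_iff_continuousAt.2 fun x => (hG x).continuousAt
  have hHc : Continuous (fderiv ℝ (fderiv ℝ f)) :=
    (hf.fderiv_right (m := 1) (by norm_num)).continuous_fderiv (by norm_num)
  have hG'n : ∀ x, ‖G' x‖ ≤ ‖fderiv ℝ (fderiv ℝ f) x‖ := by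
    intro x
    refine ContinuousLinearMap.opNorm_le_bound _ (ContinuousLinearMap.opNorm_nonneg _) fun v => ?_
    have h1 : ‖G' x v‖ * ‖G' x v‖ ≤ ‖fderiv ℝ (fderiv ℝ f) x‖ * ‖v‖ * ‖G' x v‖ := by
      rw [← real_inner_self_eq_norm_mul_norm, hG']
      exact (le_abs_self _).trans ((fderiv ℝ (fderiv ℝ f) x).le_opNorm₂ v (G' x v))
    rcases eq_or_lt_of_le (norm_nonneg (G' x v)) with h | h
    · rw [← h]; positivity
    · exact le_of_mul_le_mul_right h1 h
  obtain ⟨R, hR⟩ := hK.isBounded.subset_closedBall 0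
  obtain ⟨L, hL⟩ := (isCompact_closedBall (0 : E) (R + 1)).exists_bound_of_continuousOn
    (E := E →L[ℝ] E →L[ℝ] ℝ) hHc.continuousOn
  obtain ⟨M, hM⟩ := hK.exists_bound_of_continuousOn hGc.continuousOn
  -- a uniform lower bound of the second derivative at the critical points
  obtain ⟨l₀, hl₀, hlow₀⟩ : ∃ l > 0, ∀ m ∈ K, G m = 0 → ∀ v,
      l * ‖v‖ ^ 2 ≤ fderiv ℝ (fderiv ℝ f) m v v := by
    have hC : IsCompact ((K ∩ G ⁻¹' {0}) ×ˢ Metric.sphere (0 : E) 1) :=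
      (hK.inter_right (isClosed_singleton.preimage hGc)).prod (isCompact_sphere _ _)
    have hcont : Continuous fun z : E × E => fderiv ℝ (fderiv ℝ f) z.1 z.2 z.2 :=
      ((hHc.comp continuous_fst).clm_apply continuous_snd).clm_apply continuous_snd
    rcases ((K ∩ G ⁻¹' {0}) ×ˢ Metric.sphere (0 : E) 1).eq_empty_or_nonempty with hemp | hne
    · refine ⟨1, one_pos, fun m hm hGm v => ?_⟩
      have hv : v = 0 := by
        by_contra hv
        have : (m, ‖v‖⁻¹ • v) ∈ ((K ∩ G ⁻¹' {0}) ×ˢ Metric.sphere (0 : E) 1) :=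
          ⟨⟨hm, hGm⟩, by simp [norm_smul, hv]⟩
        rw [hemp] at this
        exact this
      simp [hv]
    · obtain ⟨z, hz, hmin⟩ := hC.exists_isMinOn hne hcont.continuousOn
      refine ⟨_, hpos z.1 hz.1.2 z.2 (ne_zero_of_mem_unit_sphere ⟨z.2, hz.2⟩),
        fun m hm hGm v => ?_⟩
      rcases eq_or_ne v 0 with rfl | hv
      · simp
      · have h1 := hmin (show (m, ‖v‖⁻¹ • v) ∈ _ from ⟨⟨hm, hGm⟩, by simp [norm_smul, hv]⟩)
        simp only [mem_ofPred_eq, map_smul, smul_apply, smul_eq_mul] at h1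
        have h2 : 0 < ‖v‖ := norm_pos_iff.2 hv
        calc _ ≤ (‖v‖⁻¹ * (‖v‖⁻¹ * fderiv ℝ (fderiv ℝ f) m v v)) * ‖v‖ ^ 2 := by gcongr
          _ = _ := by field_simp
  obtain ⟨l, hl, hl1, hlow⟩ : ∃ l > 0, l ≤ 1 ∧ ∀ m ∈ K, G m = 0 → ∀ v,
      l * ‖v‖ ^ 2 ≤ fderiv ℝ (fderiv ℝ f) m v v :=
    ⟨min l₀ 1, by positivity, min_le_right _ _, fun m hm hGm v =>
      (mul_le_mul_of_nonneg_right (min_le_left _ _) (sq_nonneg _)).trans (hlow₀ m hm hGm v)⟩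
  set L' := max L 1 with hL'
  have hL'1 : 1 ≤ L' := le_max_right _ _
  set M' := max M 1 with hM'
  have hM'1 : 1 ≤ M' := le_max_right _ _
  set η := min (min (1 / (2 * L')) (1 / M')) (l / L' ^ 2) with hη
  have hη0 : 0 < η := by positivity
  have hη1 : η * L' ≤ 1 / 2 := by
    have : η ≤ 1 / (2 * L') := (min_le_left _ _).trans (min_le_left _ _)
    calc _ ≤ 1 / (2 * L') * L' := by gcongr
      _ = 1 / 2 := by field_simp
  have hη2 : η * M' ≤ 1 := by
    have : η ≤ 1 / M' := (min_le_left _ _).trans (min_le_right _ _)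
    calc _ ≤ 1 / M' * M' := by gcongr
      _ = 1 := by field_simp
  have hη3 : η * L' ^ 2 ≤ l := by
    have : η ≤ l / L' ^ 2 := min_le_right _ _
    calc _ ≤ l / L' ^ 2 * L' ^ 2 := by gcongr
      _ = l := by field_simp
  refine ⟨η, hη0, fun x hx => ?_, fun m hm hGm => ?_⟩
  · refine gradient_step_le hf hGf hη0 (L := L') (fun t ht => ?_) hη1 (by positivity)
    have hxB : x ∈ Metric.closedBall (0 : E) (R + 1) :=
      Metric.closedBall_subset_closedBall (by linarith) (hR hx)
    have hyB : x - (t * η) • G x ∈ Metric.closedBall (0 : E) (R + 1) := by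
      have h1 := hR hx
      rw [mem_closedBall_zero_iff] at h1 ⊢
      refine (norm_sub_le _ _).trans (add_le_add h1 ?_)
      rw [norm_smul, Real.norm_eq_abs, abs_of_nonneg (mul_nonneg ht.1 hη0.le)]
      have h2 : ‖G x‖ ≤ M' := (hM x hx).trans (le_max_left _ _)
      calc t * η * ‖G x‖ ≤ 1 * η * M' := by gcongr; exact ht.2
        _ ≤ 1 := by linarith
    have := (convex_closedBall (0 : E) (R + 1)).norm_image_sub_le_of_norm_hasFDerivWithin_le
      (fun z _ => (hG z).hasFDerivWithinAt)
      (fun z hz => ((hG'n z).trans (hL z hz)).trans (le_max_left L 1)) hxB hyB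
    refine this.trans (le_of_eq ?_)
    rw [sub_sub_cancel_left, norm_neg]
  · have hηl : η * l ≤ 1 := by nlinarith
    refine ⟨√(1 - η * l), ?_, fun v => ?_⟩
    · rw [Real.sqrt_lt' one_pos]
      nlinarith [mul_pos hη0 hl]
    · refine abs_le_of_sq_le_sq' ?_ (by positivity) |>.2
      have hGv : ‖G' m v‖ ≤ L' * ‖v‖ := ((G' m).le_opNorm v).trans (by
        gcongr
        exact ((hG'n m).trans (hL m (Metric.closedBall_subset_closedBall (by linarith)
          (hR hm)))).trans (le_max_left _ _))
      rw [mul_pow, Real.sq_sqrt (by linarith), norm_sub_sq_real, inner_smul_right, real_inner_comm,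
        hG', norm_smul, Real.norm_eq_abs, abs_of_pos hη0]
      have h1 := hlow m hm hGm v
      have h2 : (η * ‖G' m v‖) ^ 2 ≤ η * l * ‖v‖ ^ 2 := by
        calc _ ≤ (η * (L' * ‖v‖)) ^ 2 := by gcongr
          _ = η * (η * L' ^ 2) * ‖v‖ ^ 2 := by ring
          _ ≤ _ := by gcongr
      nlinarith [mul_le_mul_of_nonneg_left h1 hη0.le]

/-- A coercive function all of whose critical points are nondegenerate local minima has at most
one critical point. -/
theorem eq_of_fderiv_eq_zero_of_coercive {f : E → ℝ} (hf : ContDiff ℝ 2 f)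
    (hco : Tendsto f (cocompact E) atTop)
    (hpos : ∀ m, fderiv ℝ f m = 0 → ∀ v ≠ 0, 0 < fderiv ℝ (fderiv ℝ f) m v v) {a b : E}
    (ha : fderiv ℝ f a = 0) (hb : fderiv ℝ f b = 0) : a = b := by
  obtain ⟨G, G', hG, hGf, hG'⟩ := exists_gradient hf
  have hGc : Continuous G := continuous_iff_continuousAt.2 fun x => (hG x).continuousAt
  have hcrit : ∀ m, fderiv ℝ f m = 0 ↔ G m = 0 := by
    intro m
    constructor
    · intro h
      rw [← inner_self_eq_zero (𝕜 := ℝ), hGf, h]; simp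
    · intro h
      ext v
      rw [← hGf, h]; simp
  have hpos' : ∀ m, G m = 0 → ∀ v ≠ 0, 0 < fderiv ℝ (fderiv ℝ f) m v v :=
    fun m hm => hpos m ((hcrit m).2 hm)
  obtain ⟨z, -, hz⟩ := (show IsCompact (segment ℝ a b) by
    rw [segment_eq_image_lineMap]
    exact isCompact_Icc.image AffineMap.lineMap_continuous).exists_isMaxOn ⟨a, left_mem_segment ℝ a b⟩
    hf.continuous.continuousOn
  set K := {x | f x ≤ f z} with hKdef
  have hKcl : IsClosed K := isClosed_le hf.continuous continuous_const
  have hK : IsCompact K := by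
    obtain ⟨t, ht, ht'⟩ := mem_cocompact.1 (hco.eventually_gt_atTop (f z))
    refine ht.of_isClosed_subset hKcl fun x hx => ?_
    by_contra hxt
    exact absurd (show f z < f x from ht' hxt) (not_lt.2 hx)
  have hseg : segment ℝ a b ⊆ K := fun x hx => hz hx
  obtain ⟨η, hη, hdec, hcontr⟩ := exists_uniform_gradient_step hf hG hGf hG' hpos' hK
  set g : E → E := fun x => x - η • G x with hg
  have hgc : Continuous g := continuous_id.sub (hGc.const_smul η)
  have hgK : ∀ x ∈ K, ∀ n, g^[n] x ∈ K := by
    intro x hx n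
    induction n with
    | zero => exact hx
    | succ n ih =>
      rw [Function.iterate_succ_apply']
      have h1 := hdec _ ih
      have h2 : 0 ≤ η / 2 * ‖G (g^[n] x)‖ ^ 2 := by positivity
      have h3 : f (g^[n] x) ≤ f z := ih
      change f (g (g^[n] x)) ≤ f z
      linarith
  have hattr : ∀ m ∈ K, G m = 0 →
      ∃ r > 0, ∀ y ∈ Metric.ball m r, Tendsto (fun n => g^[n] y) atTop (𝓝 m) := by
    intro m hm hGm
    obtain ⟨q, hq, hq'⟩ := hcontr m hm hGm
    refine eventually_tendsto_iterate_of_contracting (g' := .id ℝ E - η • G' m) ?_ ?_ hq hq'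
    · simp [hg, hGm]
    · exact (hasFDerivAt_id m).sub ((hG m).const_smul η)
  have hconv : ∀ x ∈ K, ∃ m ∈ K, G m = 0 ∧ Tendsto (fun n => g^[n] x) atTop (𝓝 m) := by
    intro x hx
    obtain ⟨m, hm, φ, hφ, hlim⟩ := hK.tendsto_subseq (hgK x hx)
    have hfm : Antitone fun n => f (g^[n] x) := antitone_nat_of_succ_le fun n => by
      rw [Function.iterate_succ_apply']
      have h1 := hdec _ (hgK x hx n)
      have h2 : 0 ≤ η / 2 * ‖G (g^[n] x)‖ ^ 2 := by positivity
      change f (g (g^[n] x)) ≤ _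
      linarith
    have hflim : Tendsto (fun n => f (g^[φ n] x)) atTop (𝓝 (f m)) :=
      (hf.continuous.tendsto m).comp hlim
    have hfall : Tendsto (fun n => f (g^[n] x)) atTop (𝓝 (f m)) :=
      (tendsto_iff_tendsto_subseq_of_antitone hfm hφ.tendsto_atTop).2 hflim
    have hGlim : Tendsto (fun n => ‖G (g^[n] x)‖ ^ 2) atTop (𝓝 0) := by
      have h1 : Tendsto (fun n => 2 / η * (f (g^[n] x) - f (g^[n + 1] x))) atTop (𝓝 0) := by
        have := (hfall.sub (hfall.comp (tendsto_add_atTop_nat 1))).const_mul (2 / η)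
        simpa using this
      refine squeeze_zero (fun _ => by positivity) (fun n => ?_) h1
      rw [Function.iterate_succ_apply']
      have h2 : f (g (g^[n] x)) ≤ _ := hdec _ (hgK x hx n)
      have h3 : η / 2 * ‖G (g^[n] x)‖ ^ 2 ≤ f (g^[n] x) - f (g (g^[n] x)) := by linarith
      calc ‖G (g^[n] x)‖ ^ 2 = 2 / η * (η / 2 * ‖G (g^[n] x)‖ ^ 2) := by field_simp
        _ ≤ _ := by gcongr
    have hGm : G m = 0 := by
      have h1 : Tendsto (fun n => ‖G (g^[φ n] x)‖ ^ 2) atTop (𝓝 (‖G m‖ ^ 2)) :=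
        (((hGc.tendsto m).comp hlim).norm).pow 2
      have h2 := tendsto_nhds_unique h1 (hGlim.comp hφ.tendsto_atTop)
      simpa using h2
    refine ⟨m, hm, hGm, ?_⟩
    obtain ⟨r, hr, hball⟩ := hattr m hm hGm
    obtain ⟨n, hn⟩ := (hlim.eventually (Metric.ball_mem_nhds m hr)).exists
    have := hball _ hn
    rw [← tendsto_add_atTop_iff_nat (φ n)]
    simpa [Function.iterate_add_apply] using this
  have hopen : ∀ m ∈ K, G m = 0 → IsOpen {x | Tendsto (fun n => g^[n] x) atTop (𝓝 m)} := by
    intro m hm hGm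
    obtain ⟨r, hr, hball⟩ := hattr m hm hGm
    rw [isOpen_iff_mem_nhds]
    intro x hx
    obtain ⟨n, hn⟩ := (hx.eventually (Metric.ball_mem_nhds m hr)).exists
    filter_upwards [(hgc.iterate n).continuousAt.preimage_mem_nhds
      (Metric.isOpen_ball.mem_nhds hn)] with y hy
    rw [← tendsto_add_atTop_iff_nat n]
    simpa [Function.iterate_add_apply] using hball _ hy
  have hfix : ∀ m, G m = 0 → Tendsto (fun n => g^[n] m) atTop (𝓝 m) := by
    intro m hm
    have : ∀ n, g^[n] m = m := fun n => Function.iterate_fixed (by simp [hg, hm]) n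
    simp [this]
  have haK : a ∈ K := hseg (left_mem_segment ℝ a b)
  have hbK : b ∈ K := hseg (right_mem_segment ℝ a b)
  have hGa := (hcrit a).1 ha
  have hGb := (hcrit b).1 hb
  by_contra hab
  obtain ⟨x, -, hx1, hx2⟩ := (convex_segment (𝕜 := ℝ) a b).isPreconnected
    {x | Tendsto (fun n => g^[n] x) atTop (𝓝 a)}
    (⋃ m ∈ {m | m ∈ K ∧ G m = 0 ∧ m ≠ a}, {x | Tendsto (fun n => g^[n] x) atTop (𝓝 m)})
    (hopen a haK hGa) (isOpen_biUnion fun m hm => hopen m hm.1 hm.2.1)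
    (fun x hx => by
      obtain ⟨m, hm, hGm, hlim⟩ := hconv x (hseg hx)
      by_cases hma : m = a
      · exact Or.inl (hma ▸ hlim)
      · exact Or.inr (mem_biUnion (show m ∈ {m | m ∈ K ∧ G m = 0 ∧ m ≠ a} from ⟨hm, hGm, hma⟩) hlim))
    ⟨a, left_mem_segment ℝ a b, hfix a hGa⟩
    ⟨b, right_mem_segment ℝ a b,
      mem_biUnion (show b ∈ {m | m ∈ K ∧ G m = 0 ∧ m ≠ a} from ⟨hbK, hGb, Ne.symm hab⟩) (hfix b hGb)⟩
  simp only [mem_iUnion] at hx2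
  obtain ⟨m, hm, hlim⟩ := hx2
  exact hm.2.2 (tendsto_nhds_unique hlim hx1)

end GradientDescent

section General

variable {E : Type*} [NormedAddCommGroup E] [NormedSpace ℝ E]

theorem pos_of_nonneg_of_nondegenerate {H : E →L[ℝ] E →L[ℝ] ℝ} (hs : ∀ v w, H v w = H w v)
    (hnd : ∀ v, (∀ w, H v w = 0) → v = 0) (h0 : ∀ v, 0 ≤ H v v) {v : E} (hv : v ≠ 0) :
    0 < H v v := by
  refine (h0 v).lt_of_ne fun hvv => hv (hnd v fun w => ?_)
  have hq : ∀ t : ℝ, 0 ≤ H w w + 2 * t * H v w := by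
    intro t
    have := h0 (w + t • v)
    simp only [map_add, map_smul, add_apply, smul_apply,
      smul_eq_mul, hs w v, ← hvv] at this
    linarith
  by_contra hne
  have h1 := hq (-(H w w + 1) / (2 * H v w))
  have h2 : 2 * (-(H w w + 1) / (2 * H v w)) * H v w = -(H w w + 1) := by field_simp
  rw [h2] at h1
  linarith

variable [FiniteDimensional ℝ E]

/-- `eq_of_fderiv_eq_zero_of_coercive` without a choice of inner product. -/
theorem eq_of_fderiv_eq_zero_of_coercive' {f : E → ℝ} (hf : ContDiff ℝ 2 f)
    (hco : Tendsto f (cocompact E) atTop)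
    (hpos : ∀ m, fderiv ℝ f m = 0 → ∀ v ≠ 0, 0 < fderiv ℝ (fderiv ℝ f) m v v) {a b : E}
    (ha : fderiv ℝ f a = 0) (hb : fderiv ℝ f b = 0) : a = b := by
  let e : EuclideanSpace ℝ (Fin (Module.finrank ℝ E)) ≃L[ℝ] E := toEuclidean.symm
  have hd1 : ∀ x, fderiv ℝ (f ∘ e) x = (fderiv ℝ f (e x)).comp e.toContinuousLinearMap := fun x =>
    ((hf.differentiable (by norm_num) (e x)).hasFDerivAt.comp x e.hasFDerivAt).fderiv
  have hdd : Differentiable ℝ (fderiv ℝ f) :=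
    (hf.fderiv_right (m := 1) (by norm_num)).differentiable (by norm_num)
  have hd2 : ∀ x v w, fderiv ℝ (fderiv ℝ (f ∘ e)) x v w =
      fderiv ℝ (fderiv ℝ f) (e x) (e v) (e w) := by
    intro x v w
    have h1 := (((hdd (e x)).hasFDerivAt.comp x e.hasFDerivAt).clm_comp
      (hasFDerivAt_const e.toContinuousLinearMap x))
    have h2 : fderiv ℝ (f ∘ e) = fun x => (fderiv ℝ f (e x)).comp e.toContinuousLinearMap :=
      funext hd1
    rw [h2]
    erw [h1.fderiv]
    simp
  have hz : ∀ x, fderiv ℝ (f ∘ e) x = 0 ↔ fderiv ℝ f (e x) = 0 := by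
    intro x
    rw [hd1]
    constructor
    · intro h
      ext v
      have := DFunLike.congr_fun h (e.symm v)
      simpa using this
    · intro h
      rw [h]; simp
  refine e.symm.injective (eq_of_fderiv_eq_zero_of_coercive (f := f ∘ e)
    (hf.comp e.contDiff) (hco.comp e.toHomeomorph.isClosedEmbedding.tendsto_cocompact) ?_ ?_ ?_)
  · intro m hm v hv
    rw [hd2]
    exact hpos _ ((hz m).1 hm) _ (by simpa using hv)
  · rw [hz]; simpa using ha
  · rw [hz]; simpa using hb

/-- A continuous family of nondegenerate symmetric forms over a connected space that is
nonnegative at one point is positive definite everywhere. -/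
theorem pos_of_nondegenerate_of_preconnected {Z : Type*} [TopologicalSpace Z] [PreconnectedSpace Z]
    {H : Z → E →L[ℝ] E →L[ℝ] ℝ} (hc : Continuous H) (hs : ∀ z v w, H z v w = H z w v)
    (hnd : ∀ z v, (∀ w, H z v w = 0) → v = 0) {z₀ : Z} (h0 : ∀ v, 0 ≤ H z₀ v v) (z : Z) {v : E}
    (hv : v ≠ 0) : 0 < H z v v := by
  have hcl : IsClosed {z | ∀ v, 0 ≤ H z v v} := by
    simp only [ofPred_forall]
    exact isClosed_iInter fun v => isClosed_le continuous_const
      ((hc.clm_apply continuous_const).clm_apply continuous_const)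
  have hop : IsOpen {z | ∀ v, 0 ≤ H z v v} := by
    rw [isOpen_iff_mem_nhds]
    intro z hz
    have hcont : Continuous fun y : Z × E => H y.1 y.2 y.2 :=
      ((hc.comp continuous_fst).clm_apply continuous_snd).clm_apply continuous_snd
    have h1 : ∀ᶠ y in 𝓝 z, ∀ v ∈ Metric.sphere (0 : E) 1, 0 < H y v v := by
      refine (isCompact_sphere (0 : E) 1).eventually_forall_of_forall_eventually fun v hv => ?_
      exact hcont.continuousAt.eventually (lt_mem_nhds
        (pos_of_nonneg_of_nondegenerate (hs z) (hnd z) hz (ne_zero_of_mem_unit_sphere ⟨v, hv⟩)))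
    filter_upwards [h1] with y hy v
    rcases eq_or_ne v 0 with rfl | hv
    · simp
    · have h2 := hy (‖v‖⁻¹ • v) (by simp [norm_smul, hv])
      simp only [map_smul, smul_apply, smul_eq_mul] at h2
      have h3 : 0 < ‖v‖⁻¹ := by positivity
      exact (pos_of_mul_pos_right (pos_of_mul_pos_right h2 h3.le) h3.le).le
  have huniv := IsClopen.eq_univ ⟨hcl, hop⟩ ⟨z₀, h0⟩
  have hz : z ∈ {z | ∀ v, 0 ≤ H z v v} := huniv ▸ mem_univ z
  exact pos_of_nonneg_of_nondegenerate (hs z) (hnd z) hz hv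

end General

/-! ### Periodic functions on `ℝ^d` -/

/-- Every point of `ℝ^d` has an integer translate in a fixed ball. -/
theorem exists_norm_add_intVec_le {d : ℕ} (x : Euc d) :
    ∃ r : Fin d → ℤ, ‖x + intVec r‖ ≤ √d := by
  refine ⟨fun i => -⌊x i⌋, ?_⟩
  rw [EuclideanSpace.norm_eq]
  refine Real.sqrt_le_sqrt ?_
  calc ∑ i, ‖(x + intVec fun i => -⌊x i⌋) i‖ ^ 2 ≤ ∑ _i : Fin d, (1 : ℝ) := by
        refine Finset.sum_le_sum fun i _ => ?_
        have h : (x + intVec fun i => -⌊x i⌋) i = Int.fract (x i) := by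
          simp [intVec, Int.fract, sub_eq_add_neg]
        rw [h, Real.norm_eq_abs, abs_of_nonneg (Int.fract_nonneg _)]
        exact pow_le_one₀ (Int.fract_nonneg _) (Int.fract_lt_one _).le
    _ = d := by simp

theorem exists_bound_of_periodic {d : ℕ} {F : Type*} [SeminormedAddCommGroup F] {f : Euc d → F}
    (hf : Continuous f) (hp : ∀ (r : Fin d → ℤ) x, f (x + intVec r) = f x) :
    ∃ C, ∀ x, ‖f x‖ ≤ C := by
  obtain ⟨C, hC⟩ := (isCompact_closedBall (0 : Euc d) √d).exists_bound_of_continuousOn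
    hf.continuousOn
  refine ⟨C, fun x => ?_⟩
  obtain ⟨r, hr⟩ := exists_norm_add_intVec_le x
  rw [← hp r x]
  exact hC _ (by simpa using hr)

theorem exists_forall_le_of_periodic {d : ℕ} {f : Euc d → ℝ}
    (hf : Continuous f) (hp : ∀ (r : Fin d → ℤ) x, f (x + intVec r) = f x) :
    ∃ x₀, ∀ x, f x ≤ f x₀ := by
  obtain ⟨x₀, -, hmax⟩ := (isCompact_closedBall (0 : Euc d) √d).exists_isMaxOn
    ⟨0, by simp⟩ hf.continuousOn
  refine ⟨x₀, fun x => ?_⟩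
  obtain ⟨r, hr⟩ := exists_norm_add_intVec_le x
  rw [← hp r x]
  exact hmax (show x + intVec r ∈ Metric.closedBall (0 : Euc d) √d by simpa using hr)

/-! ### Inverses of smooth bijections -/

theorem contDiff_of_inverse {E F : Type*} [NormedAddCommGroup E] [NormedSpace ℝ E]
    [FiniteDimensional ℝ E] [NormedAddCommGroup F] [NormedSpace ℝ F] [FiniteDimensional ℝ F]
    {n : WithTop ℕ∞} (hn : n ≠ 0) {f : E → F} {g : F → E} (hf : ContDiff ℝ n f)
    (hgf : Function.LeftInverse g f) (hfg : Function.RightInverse g f)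
    (hinj : ∀ x, Function.Injective (fderiv ℝ f x))
    (hdim : Module.finrank ℝ E = Module.finrank ℝ F) : ContDiff ℝ n g := by
  have : CompleteSpace E := FiniteDimensional.complete ℝ E
  rw [contDiff_iff_contDiffAt]
  intro y
  let e : E ≃L[ℝ] F :=
    (LinearEquiv.ofInjectiveOfFinrankEq (fderiv ℝ f (g y)).toLinearMap (hinj (g y))
      hdim).toContinuousLinearEquiv
  have he : (e : E →L[ℝ] F) = fderiv ℝ f (g y) := by ext v; rfl
  have hd : HasFDerivAt f (e : E →L[ℝ] F) (g y) := by
    rw [he]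
    exact (hf.differentiable hn (g y)).hasFDerivAt
  have h1 := hf.contDiffAt.to_localInverse hd hn
  rw [hfg y] at h1
  refine h1.congr_of_eventuallyEq ?_
  have h2 := (hf.contDiffAt.hasStrictFDerivAt' hd hn).eventually_right_inverse
  rw [hfg y] at h2
  filter_upwards [h2] with w hw
  have := congrArg g hw
  rw [hgf] at this
  exact this.symm

namespace GeneratingFunction

variable {d : ℕ} (Φ : GeneratingFunction d)

/-! ### The second derivative of the generating function -/

/-- The second derivative of `S` at `(x, y)`. -/
def hess (x y : Euc d) : (Euc d × Euc d) →L[ℝ] (Euc d × Euc d) →L[ℝ] ℝ :=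
  fderiv ℝ (fderiv ℝ Φ.S) (x, y)

theorem hess_symm (x y : Euc d) (u v : Euc d × Euc d) : Φ.hess x y u v = Φ.hess x y v u := by
  have : IsSymmSndFDerivAt ℝ Φ.S (x, y) :=
    Φ.contDiff.contDiffAt.isSymmSndFDerivAt (by simp)
  exact this u v

theorem continuous_hess : Continuous fun z : Euc d × Euc d => Φ.hess z.1 z.2 :=
  Φ.contDiff_fderiv.continuous_fderiv (by norm_num)

theorem exists_hess_le : ∃ A : ℝ, 0 < A ∧ ∀ x y ξ : Euc d,
    Φ.hess x y (0, ξ) (ξ, 0) ≤ -A * ‖ξ‖ ^ 2 := by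
  obtain ⟨A, hA, h⟩ := Φ.twist
  refine ⟨A, hA, fun x y ξ => ?_⟩
  rw [hess, ← fderiv_partialFst_apply]
  exact h x y ξ

theorem hess_add (r : Fin d → ℤ) (x y : Euc d) :
    Φ.hess (x + intVec r) (y + intVec r) = Φ.hess x y := by
  have h1 : ∀ z, fderiv ℝ Φ.S (z + (intVec r, intVec r)) = fderiv ℝ Φ.S z := by
    intro z
    rw [← fderiv_comp_add_right]
    congr 1
    ext z'
    exact Φ.periodic r z'.1 z'.2
  have h2 : fderiv ℝ (fderiv ℝ Φ.S) ((x, y) + (intVec r, intVec r)) =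
      fderiv ℝ (fderiv ℝ Φ.S) (x, y) := by
    rw [← fderiv_comp_add_right]
    simp_rw [h1]
  exact h2

theorem eq_zero_of_hess_eq_zero {x y ξ : Euc d} (h : ∀ u, Φ.hess x y (0, ξ) (u, 0) = 0) :
    ξ = 0 := by
  obtain ⟨A, hA, hA'⟩ := Φ.exists_hess_le
  have h1 := hA' x y ξ
  rw [h ξ] at h1
  by_contra hξ
  have h2 : 0 < A * ‖ξ‖ ^ 2 := by positivity
  linarith

theorem partialFst_apply (x y u : Euc d) : partialFst Φ.S x y u = fderiv ℝ Φ.S (x, y) (u, 0) := by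
  simp [partialFst_eq]

theorem partialSnd_apply (x y u : Euc d) : partialSnd Φ.S x y u = fderiv ℝ Φ.S (x, y) (0, u) := by
  simp [partialSnd_eq]

/-- `S (x, y)` grows at least linearly with `‖y - x‖`. -/
theorem exists_norm_sub_le : ∃ C, ∀ x y, ‖y - x‖ - C ≤ Φ.S (x, y) := by
  obtain ⟨A, hA, hess_le⟩ := Φ.exists_hess_le
  have hdiag : Continuous fun x : Euc d => (x, x) := continuous_id.prodMk continuous_id
  obtain ⟨C₀, hC₀⟩ := exists_bound_of_periodic (f := fun x => Φ.S (x, x))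
    (Φ.contDiff.continuous.comp hdiag) fun r x => Φ.periodic r x x
  obtain ⟨C₁, hC₁⟩ := exists_bound_of_periodic (f := fun x => partialSnd Φ.S x x) (by
    simp_rw [partialSnd_eq]
    exact (Φ.contDiff_fderiv.continuous.comp hdiag).clm_comp continuous_const)
    fun r x => Φ.partialSnd_add r x x
  refine ⟨C₀ + (C₁ + 1) ^ 2 / (2 * A), fun x y => ?_⟩
  set v := y - x with hv
  have hline : ∀ t : ℝ, HasDerivAt (fun t : ℝ => x + t • v) v t := fun t => by
    simpa using ((hasDerivAt_id t).smul_const v).const_add x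
  -- the derivative of the momentum when the first argument moves
  have hmom : ∀ s ∈ Icc (0 : ℝ) 1, -C₁ * ‖v‖ + s * (A * ‖v‖ ^ 2) ≤
      fderiv ℝ Φ.S (x, x + s • v) (0, v) := by
    intro s hs
    have hd : ∀ t, HasDerivAt (fun t : ℝ => fderiv ℝ Φ.S (x + t • v, x + s • v) (0, v))
        (Φ.hess (x + t • v) (x + s • v) (v, 0) (0, v)) t := by
      intro t
      have h1 := (Φ.hasFDerivAt_fderiv (x + t • v, x + s • v)).comp_hasDerivAt t
        ((hline t).prodMk (hasDerivAt_const t (x + s • v)))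
      have h2 := ((ContinuousLinearMap.apply ℝ ℝ ((0, v) : Euc d × Euc d)).hasFDerivAt).comp_hasDerivAt
        t h1
      exact h2
    have hd' : ∀ t, HasDerivAt (fun t : ℝ => fderiv ℝ Φ.S (x + t • v, x + s • v) (0, v)
        + t * (A * ‖v‖ ^ 2)) (Φ.hess (x + t • v) (x + s • v) (v, 0) (0, v) + 1 * (A * ‖v‖ ^ 2)) t :=
      fun t => (hd t).add ((hasDerivAt_id t).mul_const _)
    have hanti : AntitoneOn (fun t : ℝ => fderiv ℝ Φ.S (x + t • v, x + s • v) (0, v)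
        + t * (A * ‖v‖ ^ 2)) (Icc 0 1) := by
      refine antitoneOn_of_deriv_nonpos (convex_Icc 0 1)
        (fun t _ => (hd' t).continuousAt.continuousWithinAt)
        (fun t _ => (hd' t).differentiableAt.differentiableWithinAt)
        fun t _ => ?_
      rw [(hd' t).deriv, hess_symm]
      have := hess_le (x + t • v) (x + s • v) v
      linarith
    have h1 := hanti ⟨le_rfl, zero_le_one⟩ hs hs.1
    simp only [zero_smul, add_zero, zero_mul] at h1
    have h2 : -C₁ * ‖v‖ ≤ fderiv ℝ Φ.S (x + s • v, x + s • v) (0, v) := by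
      rw [← partialSnd_apply]
      have h3 := (partialSnd Φ.S (x + s • v) (x + s • v)).le_opNorm v
      rw [Real.norm_eq_abs] at h3
      have h4 := neg_le_of_abs_le h3
      have h5 := mul_le_mul_of_nonneg_right (hC₁ (x + s • v)) (norm_nonneg v)
      linarith
    linarith
  have hd : ∀ s, HasDerivAt (fun s : ℝ => Φ.S (x, x + s • v))
      (fderiv ℝ Φ.S (x, x + s • v) (0, v)) s := fun s =>
    (Φ.hasFDerivAt (x, x + s • v)).comp_hasDerivAt s ((hasDerivAt_const s x).prodMk (hline s))
  have hq : ∀ s : ℝ, HasDerivAt (fun s : ℝ => C₁ * ‖v‖ * s - s ^ 2 / 2 * (A * ‖v‖ ^ 2))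
      (C₁ * ‖v‖ - s * (A * ‖v‖ ^ 2)) s := by
    intro s
    have h1 := ((hasDerivAt_id s).const_mul (C₁ * ‖v‖)).sub
      ((((hasDerivAt_id s).pow 2).div_const 2).mul_const (A * ‖v‖ ^ 2))
    refine h1.congr_deriv ?_
    simp
  have hdq : ∀ s, HasDerivAt (fun s : ℝ => Φ.S (x, x + s • v) +
      (C₁ * ‖v‖ * s - s ^ 2 / 2 * (A * ‖v‖ ^ 2)))
      (fderiv ℝ Φ.S (x, x + s • v) (0, v) + (C₁ * ‖v‖ - s * (A * ‖v‖ ^ 2))) s :=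
    fun s => (hd s).add (hq s)
  have hmono : MonotoneOn (fun s : ℝ => Φ.S (x, x + s • v) +
      (C₁ * ‖v‖ * s - s ^ 2 / 2 * (A * ‖v‖ ^ 2))) (Icc 0 1) := by
    refine monotoneOn_of_deriv_nonneg (convex_Icc 0 1)
      (fun t _ => (hdq t).continuousAt.continuousWithinAt)
      (fun t _ => (hdq t).differentiableAt.differentiableWithinAt) fun t ht => ?_
    rw [(hdq t).deriv]
    have := hmom t (interior_subset ht)
    linarith
  have h1 := hmono ⟨le_rfl, zero_le_one⟩ ⟨zero_le_one, le_rfl⟩ zero_le_one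
  have h2 : x + v = y := by rw [hv]; abel
  simp only [zero_smul, add_zero, one_smul, h2, mul_zero, mul_one] at h1
  have h3 := hC₀ x
  rw [Real.norm_eq_abs] at h3
  have h4 := neg_le_of_abs_le h3
  have h5 : (C₁ + 1) * ‖v‖ - (C₁ + 1) ^ 2 / (2 * A) ≤ A / 2 * ‖v‖ ^ 2 := by
    have h6 : 0 ≤ (A * ‖v‖ - (C₁ + 1)) ^ 2 / (2 * A) := by positivity
    have h7 : (A * ‖v‖ - (C₁ + 1)) ^ 2 / (2 * A) =
        A / 2 * ‖v‖ ^ 2 - (C₁ + 1) * ‖v‖ + (C₁ + 1) ^ 2 / (2 * A) := by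
      field_simp
      ring
    linarith
  linarith

/-! ### Smoothness and derivative of the twist map -/

theorem hasFDerivAt_partialFst (z : Euc d × Euc d) :
    HasFDerivAt (fun z : Euc d × Euc d => partialFst Φ.S z.1 z.2)
      ((ContinuousLinearMap.compL ℝ (Euc d) (Euc d × Euc d) ℝ).flip
        (ContinuousLinearMap.inl ℝ (Euc d) (Euc d)) ∘L Φ.hess z.1 z.2) z := by
  simp_rw [partialFst_eq]
  exact (((ContinuousLinearMap.compL ℝ (Euc d) (Euc d × Euc d) ℝ).flip
    (ContinuousLinearMap.inl ℝ (Euc d) (Euc d))).hasFDerivAt).comp z (Φ.hasFDerivAt_fderiv z)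

theorem hasFDerivAt_partialSnd (z : Euc d × Euc d) :
    HasFDerivAt (fun z : Euc d × Euc d => partialSnd Φ.S z.1 z.2)
      ((ContinuousLinearMap.compL ℝ (Euc d) (Euc d × Euc d) ℝ).flip
        (ContinuousLinearMap.inr ℝ (Euc d) (Euc d)) ∘L Φ.hess z.1 z.2) z := by
  simp_rw [partialSnd_eq]
  exact (((ContinuousLinearMap.compL ℝ (Euc d) (Euc d × Euc d) ℝ).flip
    (ContinuousLinearMap.inr ℝ (Euc d) (Euc d))).hasFDerivAt).comp z (Φ.hasFDerivAt_fderiv z)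

theorem lift_momentum (z : CotEuc d) : z.2 = -partialFst Φ.S z.1 (Φ.lift z).1 :=
  ((Φ.lift_eq_iff z.1 z.2 _ _).1 rfl).1

theorem lift_snd (z : CotEuc d) : (Φ.lift z).2 = partialSnd Φ.S z.1 (Φ.lift z).1 :=
  ((Φ.lift_eq_iff z.1 z.2 _ _).1 rfl).2

theorem contDiff_lift {k : WithTop ℕ∞} (hk : 1 ≤ k) (hS : ContDiff ℝ (k + 1) Φ.S) :
    ContDiff ℝ k Φ.lift := by
  have hk0 : k ≠ 0 := fun h => by simp [h] at hk
  have hS' : ContDiff ℝ k (fderiv ℝ Φ.S) := hS.fderiv_right le_rfl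
  have h1 : ContDiff ℝ k fun z : Euc d × Euc d => partialFst Φ.S z.1 z.2 := by
    simp_rw [partialFst_eq]
    exact hS'.clm_comp contDiff_const
  have h2 : ContDiff ℝ k fun z : Euc d × Euc d => partialSnd Φ.S z.1 z.2 := by
    simp_rw [partialSnd_eq]
    exact hS'.clm_comp contDiff_const
  have h3 : ContDiff ℝ k fun z : CotEuc d => (z.1, (Φ.lift z).1) := by
    refine contDiff_of_inverse (f := fun z : Euc d × Euc d => (z.1, -partialFst Φ.S z.1 z.2)) hk0
      (contDiff_fst.prodMk h1.neg) ?_ ?_ ?_ ?_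
    · rintro ⟨x, y⟩
      have := (Φ.lift_eq_iff x (-partialFst Φ.S x y) y (partialSnd Φ.S x y)).2 ⟨rfl, rfl⟩
      simp [this]
    · rintro ⟨x, p⟩
      simp [← Φ.lift_momentum (x, p)]
    · intro z
      have hd := (hasFDerivAt_fst (𝕜 := ℝ) (p := z)).prodMk (Φ.hasFDerivAt_partialFst z).neg
      change Function.Injective (fderiv ℝ (fun x : Euc d × Euc d =>
        (x.1, (-fun z : Euc d × Euc d => partialFst Φ.S z.1 z.2) x)) z)
      rw [hd.fderiv, injective_iff_map_eq_zero]
      rintro ⟨ξ, ξ'⟩ h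
      simp only [ContinuousLinearMap.prod_apply, Prod.mk_eq_zero] at h
      obtain ⟨h, h'⟩ := h
      have hξ : ξ = 0 := h
      subst hξ
      have : ξ' = 0 := Φ.eq_zero_of_hess_eq_zero (x := z.1) (y := z.2) fun u => by
        have := DFunLike.congr_fun h' u
        simpa using this
      rw [this]; rfl
    · rw [Module.finrank_prod, Module.finrank_prod]
      congr 1
      exact (InnerProductSpace.toDual ℝ (Euc d)).toLinearEquiv.finrank_eq
  have h4 : (Φ.lift : CotEuc d → CotEuc d) =
      fun z => ((Φ.lift z).1, partialSnd Φ.S z.1 (Φ.lift z).1) := by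
    ext1 z
    rw [← lift_snd]
  rw [h4]
  exact (contDiff_snd.comp h3).prodMk (h2.comp h3)

theorem contDiff_one_lift : ContDiff ℝ 1 Φ.lift :=
  Φ.contDiff_lift le_rfl (by simpa [one_add_one_eq_two] using Φ.contDiff)

theorem hasFDerivAt_lift (z : CotEuc d) : HasFDerivAt Φ.lift (fderiv ℝ Φ.lift z) z :=
  (Φ.contDiff_one_lift.differentiable (by norm_num) z).hasFDerivAt

theorem hasFDerivAt_generating_pair (z : CotEuc d) :
    HasFDerivAt (fun z : CotEuc d => (z.1, (Φ.lift z).1))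
      ((ContinuousLinearMap.fst ℝ (Euc d) (EucDual d)).prod
        ((ContinuousLinearMap.fst ℝ (Euc d) (EucDual d)).comp (fderiv ℝ Φ.lift z))) z :=
  hasFDerivAt_fst.prodMk (hasFDerivAt_fst.comp z (Φ.hasFDerivAt_lift z))

theorem fderiv_lift_momentum (z v : CotEuc d) (u : Euc d) :
    v.2 u = -Φ.hess z.1 (Φ.lift z).1 (v.1, (fderiv ℝ Φ.lift z v).1) (u, 0) := by
  have h1 := ((Φ.hasFDerivAt_partialFst (z.1, (Φ.lift z).1)).comp z
    (Φ.hasFDerivAt_generating_pair z)).neg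
  have h2 : HasFDerivAt (fun z : CotEuc d => z.2) _ z := h1.congr_of_eventuallyEq
    (Eventually.of_forall fun y => Φ.lift_momentum y)
  have h3 := DFunLike.congr_fun (DFunLike.congr_fun (h2.unique hasFDerivAt_snd) v) u
  simpa using h3.symm

theorem fderiv_lift_snd (z v : CotEuc d) (u : Euc d) :
    (fderiv ℝ Φ.lift z v).2 u =
      Φ.hess z.1 (Φ.lift z).1 (v.1, (fderiv ℝ Φ.lift z v).1) (0, u) := by
  have h1 := (Φ.hasFDerivAt_partialSnd (z.1, (Φ.lift z).1)).comp z
    (Φ.hasFDerivAt_generating_pair z)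
  have h2 : HasFDerivAt (fun z : CotEuc d => (Φ.lift z).2) _ z := h1.congr_of_eventuallyEq
    (Eventually.of_forall fun y => Φ.lift_snd y)
  have h3 := DFunLike.congr_fun (DFunLike.congr_fun
    (h2.unique (hasFDerivAt_snd.comp z (Φ.hasFDerivAt_lift z))) v) u
  simpa using h3.symm

/-- The derivative of the twist map is determined by the second derivative of `S`. -/
theorem fderiv_lift_eq {z v : CotEuc d} {v' : CotEuc d}
    (h : ∀ u, v.2 u = -Φ.hess z.1 (Φ.lift z).1 (v.1, v'.1) (u, 0))
    (h' : ∀ u, v'.2 u = Φ.hess z.1 (Φ.lift z).1 (v.1, v'.1) (0, u)) :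
    fderiv ℝ Φ.lift z v = v' := by
  have h1 : (fderiv ℝ Φ.lift z v).1 = v'.1 := by
    rw [← sub_eq_zero]
    refine Φ.eq_zero_of_hess_eq_zero (x := z.1) (y := (Φ.lift z).1) fun u => ?_
    have h2 := (h u).symm.trans (Φ.fderiv_lift_momentum z v u)
    have h3 : ((0 : Euc d), (fderiv ℝ Φ.lift z v).1 - v'.1) =
        (v.1, (fderiv ℝ Φ.lift z v).1) - (v.1, v'.1) := by simp
    rw [h3, map_sub, sub_apply]
    linarith
  refine Prod.ext h1 ?_
  ext1 u
  rw [fderiv_lift_snd, h1, h']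

theorem contDiff_lift_pow {k : WithTop ℕ∞} (h : ContDiff ℝ k Φ.lift) (n : ℕ) :
    ContDiff ℝ k (Φ.lift ^ n : Equiv.Perm (CotEuc d)) := by
  induction n with
  | zero => exact contDiff_id
  | succ n ih =>
    rw [pow_succ']
    exact h.comp ih

end GeneratingFunction

/-! ### Differential calculus on `T^*𝕋^d` -/

section Torus

variable {d : ℕ}

theorem extChartAt_torus_symm (θ : Torus d) (x : Euc d) :
    (extChartAt 𝓘(ℝ, Euc d) θ).symm x = torusMk x := by
  change (((isLocalHomeomorph_torusMk.localInverseAt θ.out).trans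
    (chartAt (Euc d) θ.out)).extend 𝓘(ℝ, Euc d)).symm x = _
  simp [chartAt_self_eq]

theorem extChartAt_torus (θ η : Torus d) :
    extChartAt 𝓘(ℝ, Euc d) θ η = isLocalHomeomorph_torusMk.localInverseAt θ.out η := by
  change (((isLocalHomeomorph_torusMk.localInverseAt θ.out).trans
    (chartAt (Euc d) θ.out)).extend 𝓘(ℝ, Euc d)) η = _
  simp [chartAt_self_eq]

theorem localInverseAt_torusMk (x : Euc d) : ∀ᶠ y in 𝓝 x,
    isLocalHomeomorph_torusMk.localInverseAt x (torusMk y) = y := by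
  filter_upwards [(isLocalHomeomorph_torusMk.localInverseAt x).open_target.mem_nhds
    isLocalHomeomorph_torusMk.self_mem_localInverseAt_target] with y hy
  have := (isLocalHomeomorph_torusMk.localInverseAt x).right_inv hy
  simpa using this

theorem hasMFDerivAt_torusMk (x : Euc d) :
    HasMFDerivAt 𝓘(ℝ, Euc d) 𝓘(ℝ, Euc d) (torusMk (d := d)) x
      (ContinuousLinearMap.id ℝ (Euc d)) := by
  refine ⟨continuous_torusMk.continuousAt, ?_⟩
  obtain ⟨r, hr⟩ := torusMk_eq_iff.1 (torusMk_out (torusMk x)).symm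
  have h1 : HasFDerivAt (fun y => isLocalHomeomorph_torusMk.localInverseAt (torusMk x).out
      (torusMk y)) (ContinuousLinearMap.id ℝ (Euc d)) x := by
    refine ((hasFDerivAt_id x).add_const (intVec r)).congr_of_eventuallyEq ?_
    have h2 : Tendsto (fun y => y + intVec r) (𝓝 x) (𝓝 (torusMk x).out) := by
      rw [hr]
      exact (continuous_id.add continuous_const).tendsto x
    filter_upwards [h2.eventually (localInverseAt_torusMk _)] with y hy
    rw [← torusMk_add y r, hy]
    rfl
  refine (h1.congr_of_eventuallyEq (Eventually.of_forall fun y => ?_)).hasFDerivWithinAt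
  change extChartAt 𝓘(ℝ, Euc d) (torusMk x) (torusMk ((extChartAt 𝓘(ℝ, Euc d) x).symm y)) = _
  rw [extChartAt_torus]
  rfl

/-- Local sections of `ℝ^d → 𝕋^d`. -/
theorem exists_torus_section (x : Euc d) : ∃ σ : Torus d → Euc d, σ (torusMk x) = x ∧
    (∀ᶠ θ in 𝓝 (torusMk x), torusMk (σ θ) = θ) ∧
    HasMFDerivAt 𝓘(ℝ, Euc d) 𝓘(ℝ, Euc d) σ (torusMk x) (ContinuousLinearMap.id ℝ (Euc d)) := by
  obtain ⟨r, hr⟩ := torusMk_eq_iff.1 (torusMk_out (torusMk x)).symm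
  set θ := torusMk x
  set e := isLocalHomeomorph_torusMk.localInverseAt θ.out
  have hθ : θ ∈ e.source := by
    have := isLocalHomeomorph_torusMk.apply_self_mem_localInverseAt_source (x := θ.out)
    rwa [torusMk_out] at this
  have heθ : e θ = θ.out := by
    have := isLocalHomeomorph_torusMk.localInverseAt_apply_self (x := θ.out)
    rwa [torusMk_out] at this
  refine ⟨fun η => e η - intVec r, ?_, ?_, ?_⟩
  · change e θ - intVec r = x
    rw [heθ, hr, add_sub_cancel_right]
  · filter_upwards [e.open_source.mem_nhds hθ] with η hη
    rw [← torusMk_add _ r, sub_add_cancel]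
    exact isLocalHomeomorph_torusMk.apply_localInverseAt_of_mem hη
  · refine ⟨(e.continuousAt hθ).sub continuousAt_const, ?_⟩
    have h1 : HasFDerivAt (fun y => e (torusMk y) - intVec r)
        (ContinuousLinearMap.id ℝ (Euc d)) θ.out :=
      ((hasFDerivAt_id _).congr_of_eventuallyEq
        (localInverseAt_torusMk θ.out)).sub_const (intVec r)
    rw [extChartAt_torus, heθ]
    refine (h1.congr_of_eventuallyEq (Eventually.of_forall fun y => ?_)).hasFDerivWithinAt
    change e ((extChartAt 𝓘(ℝ, Euc d) θ).symm y) - intVec r = _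
    rw [extChartAt_torus_symm]

theorem hasMFDerivAt_cotMk (z : CotEuc d) :
    HasMFDerivAt 𝓘(ℝ, CotEuc d) (cotModel d) (cotMk (d := d)) z
      (ContinuousLinearMap.id ℝ (CotEuc d)) := by
  have h1 : HasMFDerivAt 𝓘(ℝ, CotEuc d) 𝓘(ℝ, Euc d) (fun z : CotEuc d => torusMk z.1) z
      ((ContinuousLinearMap.id ℝ (Euc d)).comp (ContinuousLinearMap.fst ℝ (Euc d) (EucDual d))) :=
    HasMFDerivAt.comp z (hasMFDerivAt_torusMk z.1) (hasFDerivAt_fst).hasMFDerivAt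
  have h2 : HasMFDerivAt 𝓘(ℝ, CotEuc d) 𝓘(ℝ, EucDual d) (fun z : CotEuc d => z.2) z
      (ContinuousLinearMap.snd ℝ (Euc d) (EucDual d)) := (hasFDerivAt_snd).hasMFDerivAt
  exact h1.prodMk h2

/-- Local sections of `T^*ℝ^d → T^*𝕋^d`. -/
theorem exists_cot_section (z : CotEuc d) : ∃ σ : CotTorus d → CotEuc d, σ (cotMk z) = z ∧
    (∀ᶠ ω in 𝓝 (cotMk z), cotMk (σ ω) = ω) ∧
    HasMFDerivAt (cotModel d) 𝓘(ℝ, CotEuc d) σ (cotMk z)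
      (ContinuousLinearMap.id ℝ (CotEuc d)) := by
  obtain ⟨σ, hσ, hσ', hσd⟩ := exists_torus_section z.1
  refine ⟨fun ω => (σ ω.1, ω.2), Prod.ext hσ rfl, ?_, ?_⟩
  · have h1 : ∀ᶠ ω : CotTorus d in 𝓝 (cotMk z), torusMk (σ ω.1) = ω.1 :=
      (continuous_fst.tendsto (cotMk z)).eventually hσ'
    filter_upwards [h1] with ω hω
    exact Prod.ext hω rfl
  · have h1 : HasMFDerivAt (cotModel d) 𝓘(ℝ, Euc d) (fun ω : CotTorus d => σ ω.1) (cotMk z)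
        ((ContinuousLinearMap.id ℝ (Euc d)).comp
          (ContinuousLinearMap.fst ℝ (Euc d) (EucDual d))) :=
      HasMFDerivAt.comp (I' := 𝓘(ℝ, Euc d)) (cotMk z) hσd (hasMFDerivAt_fst (cotMk z))
    have h2 : HasMFDerivAt (cotModel d) 𝓘(ℝ, EucDual d) (fun ω : CotTorus d => ω.2) (cotMk z)
        (ContinuousLinearMap.snd ℝ (Euc d) (EucDual d)) := hasMFDerivAt_snd (cotMk z)
    have h3 := h1.prodMk h2
    rw [modelWithCornersSelf_prod, ← chartedSpaceSelf_prod]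
    exact h3

theorem cotDeriv_cotMk {G : CotTorus d → CotTorus d} {g : CotEuc d → CotEuc d}
    (hGg : ∀ z, G (cotMk z) = cotMk (g z)) {z : CotEuc d} (hg : DifferentiableAt ℝ g z) :
    cotDeriv G (cotMk z) = fderiv ℝ g z := by
  obtain ⟨σ, hσ, hσ', hσd⟩ := exists_cot_section z
  have h1 : HasMFDerivAt (cotModel d) 𝓘(ℝ, CotEuc d) (g ∘ σ) (cotMk z)
      ((fderiv ℝ g z).comp (ContinuousLinearMap.id ℝ (CotEuc d))) := by
    refine HasMFDerivAt.comp (I' := 𝓘(ℝ, CotEuc d)) (cotMk z) ?_ hσd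
    rw [hσ]
    exact hg.hasFDerivAt.hasMFDerivAt
  have h2 : HasMFDerivAt (cotModel d) (cotModel d) (cotMk ∘ (g ∘ σ)) (cotMk z)
      ((ContinuousLinearMap.id ℝ (CotEuc d)).comp
        ((fderiv ℝ g z).comp (ContinuousLinearMap.id ℝ (CotEuc d)))) :=
    HasMFDerivAt.comp (I' := 𝓘(ℝ, CotEuc d)) (cotMk z) (hasMFDerivAt_cotMk _) h1
  have h3 : HasMFDerivAt (cotModel d) (cotModel d) G (cotMk z)
      ((ContinuousLinearMap.id ℝ (CotEuc d)).comp
        ((fderiv ℝ g z).comp (ContinuousLinearMap.id ℝ (CotEuc d)))) := by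
    refine h2.congr_of_eventuallyEq ?_
    filter_upwards [hσ'] with ω hω
    conv_lhs => rw [← hω]
    exact hGg _
  have h4 : HasMFDerivAt (cotModel d) (cotModel d) G (cotMk z) (fderiv ℝ g z) := h3
  exact h4.mfderiv

theorem mem_verticalSpace {ω : CotTorus d} {v : CotEuc d} : v ∈ verticalSpace ω ↔ v.1 = 0 := by
  have : (mfderiv (cotModel d) 𝓘(ℝ, Euc d) cotProj ω : CotEuc d →L[ℝ] Euc d) =
      ContinuousLinearMap.fst ℝ (Euc d) (EucDual d) := (hasMFDerivAt_fst ω).mfderiv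
  unfold verticalSpace
  rw [this]
  rfl

/-! ### Graphs over the torus -/

variable {L : Set (CotTorus d)} {p : Euc d → EucDual d}

theorem tangentVectors_eq_of_graph (hp : Differentiable ℝ p)
    (hL : ∀ z : CotEuc d, cotMk z ∈ L ↔ z.2 = p z.1) (x : Euc d) :
    tangentVectors L (cotMk (x, p x)) = {v | v.2 = fderiv ℝ p x v.1} := by
  ext v
  constructor
  · rintro ⟨γ, hγL, hγ0, hγ⟩
    obtain ⟨σ, hσ, hσ', hσd⟩ := exists_cot_section (x, p x)
    have h1 : HasMFDerivAt 𝓘(ℝ, ℝ) 𝓘(ℝ, CotEuc d) (σ ∘ γ) 0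
        ((ContinuousLinearMap.id ℝ (CotEuc d)).comp (ContinuousLinearMap.toSpanSingleton ℝ v)) := by
      refine HasMFDerivAt.comp (I' := cotModel d) (0 : ℝ) ?_ hγ
      rw [hγ0]
      exact hσd
    have h2 : HasDerivAt (σ ∘ γ) v 0 := by
      have h : HasFDerivAt (σ ∘ γ) (ContinuousLinearMap.toSpanSingleton ℝ v) 0 := h1.hasFDerivAt
      simpa using h.hasDerivAt
    have h0 : (σ ∘ γ) 0 = (x, p x) := by simp [hγ0, hσ]
    have hcont : ContinuousAt γ 0 := hγ.1
    have h3 : ∀ᶠ t in 𝓝 (0 : ℝ), ((σ ∘ γ) t).2 = p ((σ ∘ γ) t).1 := by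
      have : Tendsto γ (𝓝 0) (𝓝 (cotMk (x, p x))) := by
        rw [← hγ0]; exact hcont
      filter_upwards [this.eventually hσ'] with t ht
      rw [← hL]
      change cotMk (σ (γ t)) ∈ L
      rw [ht]
      exact hγL t
    have h4 : HasDerivAt (fun t => ((σ ∘ γ) t).1) v.1 0 :=
      (hasFDerivAt_fst (𝕜 := ℝ) (p := (σ ∘ γ) 0)).comp_hasDerivAt 0 h2
    have h5 : HasDerivAt (fun t => ((σ ∘ γ) t).2) v.2 0 :=
      (hasFDerivAt_snd (𝕜 := ℝ) (p := (σ ∘ γ) 0)).comp_hasDerivAt 0 h2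
    have h6 : HasDerivAt (fun t => p ((σ ∘ γ) t).1) (fderiv ℝ p x v.1) 0 := by
      have h7 : HasFDerivAt p (fderiv ℝ p x) ((σ ∘ γ) 0).1 := by
        rw [h0]; exact (hp x).hasFDerivAt
      exact h7.comp_hasDerivAt 0 h4
    exact (h5.congr_of_eventuallyEq (h3.mono fun t ht => ht.symm)).unique h6
  · intro hv
    refine ⟨fun t => cotMk (x + t • v.1, p (x + t • v.1)), fun t => (hL _).2 rfl, by simp, ?_⟩
    have h1 : HasDerivAt (fun t : ℝ => x + t • v.1) v.1 0 := by
      simpa using ((hasDerivAt_id (0 : ℝ)).smul_const v.1).const_add x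
    have h2 : HasDerivAt (fun t : ℝ => p (x + t • v.1)) v.2 0 := by
      rw [show v.2 = fderiv ℝ p x v.1 from hv]
      have h7 : HasFDerivAt p (fderiv ℝ p x) (x + (0 : ℝ) • v.1) := by
        simpa using (hp x).hasFDerivAt
      exact h7.comp_hasDerivAt 0 h1
    have h3 : HasFDerivAt (fun t : ℝ => (x + t • v.1, p (x + t • v.1)))
        (ContinuousLinearMap.toSpanSingleton ℝ v) 0 := h1.prodMk h2
    have h4 := HasMFDerivAt.comp (0 : ℝ) (hasMFDerivAt_cotMk _) h3.hasMFDerivAt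
    exact h4

/-- The shear `(x, p) ↦ (x, p - p(x))`. -/
def shear (p : Euc d → EucDual d) (hp : Continuous p) : CotEuc d ≃ₜ CotEuc d where
  toFun z := (z.1, z.2 - p z.1)
  invFun z := (z.1, z.2 + p z.1)
  left_inv z := by simp
  right_inv z := by simp
  continuous_toFun := by fun_prop
  continuous_invFun := by fun_prop

theorem isSubmanifold_of_graph {k : WithTop ℕ∞} (hp : ContDiff ℝ k p)
    (hL : ∀ z : CotEuc d, cotMk z ∈ L ↔ z.2 = p z.1) : IsSubmanifold k d L := by
  intro ω _
  let s : OpenPartialHomeomorph (ModelProd (Euc d) (EucDual d)) (ModelProd (Euc d) (EucDual d)) :=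
    (shear p hp.continuous).toOpenPartialHomeomorph
  have hs : ContMDiff (cotModel d) (cotModel d) k s := by
    have h1 : ContDiff ℝ k fun z : CotEuc d => (z.1, z.2 - p z.1) :=
      contDiff_fst.prodMk (contDiff_snd.sub (hp.comp contDiff_fst))
    have h2 := h1.contMDiff
    rw [modelWithCornersSelf_prod] at h2
    exact h2
  have hs' : ContMDiff (cotModel d) (cotModel d) k s.symm := by
    have h1 : ContDiff ℝ k fun z : CotEuc d => (z.1, z.2 + p z.1) :=
      contDiff_fst.prodMk (contDiff_snd.add (hp.comp contDiff_fst))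
    have h2 := h1.contMDiff
    rw [modelWithCornersSelf_prod] at h2
    exact h2
  let c := chartAt (ModelProd (Euc d) (EucDual d)) ω
  have hsrc : (c.trans s).source = c.source := by
    rw [OpenPartialHomeomorph.trans_source]
    exact inter_eq_left.2 fun _ _ => mem_univ _
  refine ⟨c.trans s, ?_, ?_, LinearMap.ker (LinearMap.snd ℝ (Euc d) (EucDual d)), ?_, ?_⟩
  · refine OpenPartialHomeomorph.mem_maximalAtlas_of_contMDiffOn _ ?_ ?_
    · rw [hsrc]
      exact hs.comp_contMDiffOn (contMDiffOn_chart (I := cotModel d) (x := ω))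
    · refine (contMDiffOn_chart_symm (I := cotModel d) (x := ω)).comp hs'.contMDiffOn ?_
      intro y hy
      rw [OpenPartialHomeomorph.trans_target] at hy
      exact hy.2
  · rw [hsrc]
    exact mem_chart_source _ ω
  · rw [← LinearMap.range_inl, LinearMap.finrank_range_of_inj LinearMap.inl_injective]
    simp
  · intro η hη
    rw [hsrc] at hη
    have hc : ∀ y : CotEuc d, c.symm y = cotMk y := fun y =>
      Prod.ext (extChartAt_torus_symm ω.1 y.1) rfl
    have h1 : cotMk (c η : CotEuc d) = η := by
      rw [← hc]
      exact c.left_inv hη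
    have h2 : ((c.trans s) η : CotEuc d) = ((c η).1, (c η).2 - p (c η).1) := rfl
    have h3 := hL (c η)
    rw [h1] at h3
    rw [h3, h2]
    change _ ↔ LinearMap.snd ℝ (Euc d) (EucDual d)
      (((c η : CotEuc d).1, (c η : CotEuc d).2 - p (c η : CotEuc d).1) : CotEuc d) = 0
    rw [LinearMap.snd_apply, sub_eq_zero]

end Torus

namespace GeneratingFunction

variable {d : ℕ} (Φ : GeneratingFunction d)

theorem map_pow_cotMk (n : ℕ) (z : CotEuc d) :
    (Φ.map ^ n) (cotMk z) = cotMk ((Φ.lift ^ n) z) := by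
  induction n with
  | zero => rfl
  | succ n ih => rw [pow_succ', pow_succ', Equiv.Perm.mul_apply, ih, map_cotMk]; rfl

theorem differentiable_lift_pow (n : ℕ) :
    Differentiable ℝ (Φ.lift ^ n : Equiv.Perm (CotEuc d)) :=
  (Φ.contDiff_lift_pow Φ.contDiff_one_lift n).differentiable (by norm_num)

theorem cotDeriv_map_pow (n : ℕ) (z : CotEuc d) :
    cotDeriv (Φ.map ^ n : Equiv.Perm (CotTorus d)) (cotMk z) =
      fderiv ℝ (Φ.lift ^ n : Equiv.Perm (CotEuc d)) z :=
  cotDeriv_cotMk (Φ.map_pow_cotMk n) (Φ.differentiable_lift_pow n z)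

theorem fderiv_lift_pow_succ (n : ℕ) (z v : CotEuc d) :
    fderiv ℝ (Φ.lift ^ (n + 1) : Equiv.Perm (CotEuc d)) z v =
      fderiv ℝ Φ.lift ((Φ.lift ^ n) z) (fderiv ℝ (Φ.lift ^ n : Equiv.Perm (CotEuc d)) z v) := by
  have h := (Φ.hasFDerivAt_lift ((Φ.lift ^ n) z)).comp z (Φ.differentiable_lift_pow n z).hasFDerivAt
  have h2 : ((Φ.lift ^ (n + 1) : Equiv.Perm (CotEuc d)) : CotEuc d → CotEuc d) =
      Φ.lift ∘ (Φ.lift ^ n : Equiv.Perm (CotEuc d)) := by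
    rw [pow_succ']; rfl
  rw [h2, h.fderiv]
  rfl

theorem fderiv_lift_injective (z : CotEuc d) : Function.Injective (fderiv ℝ Φ.lift z) := by
  rw [injective_iff_map_eq_zero]
  intro v hv
  have h1 : v.1 = 0 := by
    obtain ⟨A, hA, hA'⟩ := Φ.exists_hess_le
    have h2 := Φ.fderiv_lift_snd z v v.1
    rw [hv, hess_symm] at h2
    have h3 := hA' z.1 (Φ.lift z).1 v.1
    simp only [Prod.snd_zero, Prod.fst_zero, zero_apply] at h2
    rw [← h2] at h3
    by_contra hne
    have : 0 < A * ‖v.1‖ ^ 2 := by positivity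
    linarith
  refine Prod.ext h1 ?_
  ext1 u
  rw [fderiv_lift_momentum, hv, h1]
  simp [← Prod.zero_eq_mk]

theorem fderiv_lift_pow_injective (n : ℕ) (z : CotEuc d) :
    Function.Injective (fderiv ℝ (Φ.lift ^ n : Equiv.Perm (CotEuc d)) z) := by
  induction n with
  | zero =>
    have : ((Φ.lift ^ 0 : Equiv.Perm (CotEuc d)) : CotEuc d → CotEuc d) = id := rfl
    rw [this, fderiv_id]
    exact fun _ _ h => h
  | succ n ih =>
    intro v w h
    rw [fderiv_lift_pow_succ, fderiv_lift_pow_succ] at h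
    exact ih (Φ.fderiv_lift_injective _ h)

variable {Φ} in
theorem WithoutConjugatePoints.eq_zero (hΦ : Φ.WithoutConjugatePoints) {n : ℕ} (hn : 0 < n)
    {z : CotEuc d} {w : EucDual d}
    (h : (fderiv ℝ (Φ.lift ^ n : Equiv.Perm (CotEuc d)) z (0, w)).1 = 0) : w = 0 := by
  have h1 := hΦ (cotMk z) n (by exact_mod_cast hn.ne')
  rw [zpow_natCast, cotDeriv_map_pow] at h1
  have h2 : fderiv ℝ (Φ.lift ^ n : Equiv.Perm (CotEuc d)) z (0, w) ∈ (⊥ : Submodule ℝ (CotEuc d)) := by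
    rw [← h1]
    exact ⟨mem_verticalSpace.2 h, Submodule.mem_map_of_mem (mem_verticalSpace.2 rfl)⟩
  rw [Submodule.mem_bot] at h2
  have h3 := Φ.fderiv_lift_pow_injective n z (h2.trans (map_zero _).symm)
  exact congrArg Prod.snd h3

end GeneratingFunction

/-- A sum of functionals evaluated on the consecutive pairs of a sequence with one nonzero term. -/
theorem sum_apply_single {V : Type*} [AddCommGroup V] {n k : ℕ} (hk : k + 1 < n)
    (l : ℕ → V × V → ℝ) (h0 : ∀ j, l j 0 = 0) (u : V) :
    ∑ j ∈ Finset.range n, l j (Pi.single (M := fun _ => V) (k + 1) u j,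
      Pi.single (M := fun _ => V) (k + 1) u (j + 1)) = l k (0, u) + l (k + 1) (u, 0) := by
  rw [Finset.sum_eq_add_of_mem k (k + 1) (Finset.mem_range.2 (by omega)) (Finset.mem_range.2 hk)
    (by omega)]
  · rw [Pi.single_eq_same, Pi.single_eq_of_ne (by omega), Pi.single_eq_of_ne (by omega)]
  · rintro j - ⟨h1, h2⟩
    rw [Pi.single_eq_of_ne h2, Pi.single_eq_of_ne (by omega)]
    exact h0 j

/-- The second derivative at a minimum is nonnegative. -/
theorem nonneg_fderiv_fderiv_of_isMin {E : Type*} [NormedAddCommGroup E] [NormedSpace ℝ E]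
    {f : E → ℝ} (hf : ContDiff ℝ 2 f) {x : E} (hx : ∀ y, f x ≤ f y) (v : E) :
    0 ≤ fderiv ℝ (fderiv ℝ f) x v v := by
  have hline : ∀ t : ℝ, HasDerivAt (fun t : ℝ => x + t • v) v t := fun t => by
    simpa using ((hasDerivAt_id t).smul_const v).const_add x
  have hd : ∀ t : ℝ, HasDerivAt (fun t : ℝ => f (x + t • v)) (fderiv ℝ f (x + t • v) v) t :=
    fun t => (hf.differentiable (by norm_num) _).hasFDerivAt.comp_hasDerivAt t (hline t)
  have h0 : fderiv ℝ f x v = 0 := by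
    have h1 : IsLocalMin (fun t : ℝ => f (x + t • v)) 0 :=
      Eventually.of_forall fun t => by simpa using hx _
    have := h1.hasDerivAt_eq_zero (hd 0)
    simpa using this
  have hd2 : HasDerivAt (fun t : ℝ => fderiv ℝ f (x + t • v) v)
      (fderiv ℝ (fderiv ℝ f) x v v) 0 := by
    have h1 : HasFDerivAt (fderiv ℝ f) (fderiv ℝ (fderiv ℝ f) x) (x + (0 : ℝ) • v) := by
      rw [zero_smul, add_zero]
      exact ((hf.fderiv_right (m := 1) (by norm_num)).differentiable (by norm_num) x).hasFDerivAt
    exact ((ContinuousLinearMap.apply ℝ ℝ v).hasFDerivAt).comp_hasDerivAt 0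
      (h1.comp_hasDerivAt 0 (hline 0))
  by_contra hneg
  push Not at hneg
  have h2 := hd2.tendsto_slope_zero_right
  simp only [zero_add, zero_smul, add_zero, h0, sub_zero, smul_eq_mul] at h2
  obtain ⟨ε, hε, hε'⟩ := mem_nhdsGT_iff_exists_Ioc_subset.1 (h2.eventually (gt_mem_nhds hneg))
  have hε0 : (0 : ℝ) < ε := hε
  obtain ⟨c, hc, hc'⟩ := exists_hasDerivAt_eq_slope _ _ hε0
    (fun t _ => (hd t).continuousAt.continuousWithinAt) (fun t _ => hd t)
  have h3 : c⁻¹ * fderiv ℝ f (x + c • v) v < 0 := hε' ⟨hc.1, hc.2.le⟩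
  have h4 : fderiv ℝ f (x + c • v) v < 0 := by
    have : 0 < c⁻¹ := inv_pos.2 hc.1
    exact neg_of_mul_neg_right h3 this.le
  rw [hc', zero_smul, add_zero, sub_zero] at h4
  have h5 : 0 ≤ (f (x + ε • v) - f x) / ε := div_nonneg (sub_nonneg.2 (hx _)) hε0.le
  linarith

namespace GeneratingFunction

variable {d : ℕ} (Φ : GeneratingFunction d)

/-! ### Orbits, action and its derivatives -/

/-- The positions along the orbit of `z`. -/
def orbit (z : CotEuc d) (i : ℕ) : Euc d := ((Φ.lift ^ i) z).1

/-- The action of the first `n` steps of a sequence. -/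
def action (c : ℕ → Euc d) (n : ℕ) : ℝ := ∑ i ∈ Finset.range n, Φ.S (c i, c (i + 1))

/-- The first variation of the action. -/
def firstVar (c η : ℕ → Euc d) (n : ℕ) : ℝ :=
  ∑ i ∈ Finset.range n, fderiv ℝ Φ.S (c i, c (i + 1)) (η i, η (i + 1))

/-- The second variation of the action. -/
def secondVar (c ξ η : ℕ → Euc d) (n : ℕ) : ℝ :=
  ∑ i ∈ Finset.range n, Φ.hess (c i) (c (i + 1)) (ξ i, ξ (i + 1)) (η i, η (i + 1))

@[simp] theorem orbit_zero (z : CotEuc d) : Φ.orbit z 0 = z.1 := rfl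

theorem lift_pow_succ_apply (n : ℕ) (z : CotEuc d) :
    (Φ.lift ^ (n + 1)) z = Φ.lift ((Φ.lift ^ n) z) := by
  rw [pow_succ']; rfl

theorem orbit_succ (z : CotEuc d) (i : ℕ) :
    Φ.orbit z (i + 1) = (Φ.lift ((Φ.lift ^ i) z)).1 := by
  rw [orbit, lift_pow_succ_apply]

theorem firstVar_orbit (z : CotEuc d) (η : ℕ → Euc d) (n : ℕ) :
    Φ.firstVar (Φ.orbit z) η n = ((Φ.lift ^ n) z).2 (η n) - z.2 (η 0) := by
  induction n with
  | zero => simp [firstVar]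
  | succ n ih =>
    rw [firstVar, Finset.sum_range_succ, ← firstVar, ih]
    have h1 := Φ.lift_momentum ((Φ.lift ^ n) z)
    have h2 := Φ.lift_snd ((Φ.lift ^ n) z)
    have h3 : (η n, η (n + 1)) = (η n, 0) + (0, η (n + 1)) := by simp
    rw [h3, map_add, ← partialFst_apply, ← partialSnd_apply, orbit_succ, orbit,
      lift_pow_succ_apply, h2]
    nth_rewrite 1 [h1]
    rw [neg_apply]
    ring

/-- The Jacobi field with initial value `v` along the orbit of `z`. -/
def jacobi (z v : CotEuc d) (i : ℕ) : CotEuc d :=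
  fderiv ℝ (Φ.lift ^ i : Equiv.Perm (CotEuc d)) z v

@[simp] theorem jacobi_zero (z v : CotEuc d) : Φ.jacobi z v 0 = v := by
  have : ((Φ.lift ^ 0 : Equiv.Perm (CotEuc d)) : CotEuc d → CotEuc d) = id := rfl
  rw [jacobi, this, fderiv_id]; rfl

theorem jacobi_succ (z v : CotEuc d) (i : ℕ) :
    Φ.jacobi z v (i + 1) = fderiv ℝ Φ.lift ((Φ.lift ^ i) z) (Φ.jacobi z v i) :=
  Φ.fderiv_lift_pow_succ i z v

theorem secondVar_jacobi (z v : CotEuc d) (η : ℕ → Euc d) (n : ℕ) :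
    Φ.secondVar (Φ.orbit z) (fun i => (Φ.jacobi z v i).1) η n =
      (Φ.jacobi z v n).2 (η n) - v.2 (η 0) := by
  induction n with
  | zero => simp [secondVar]
  | succ n ih =>
    rw [secondVar, Finset.sum_range_succ, ← secondVar, ih]
    have h1 := Φ.fderiv_lift_momentum ((Φ.lift ^ n) z) (Φ.jacobi z v n) (η n)
    have h2 := Φ.fderiv_lift_snd ((Φ.lift ^ n) z) (Φ.jacobi z v n) (η (n + 1))
    have h3 : (η n, η (n + 1)) = (η n, 0) + (0, η (n + 1)) := by simp
    rw [h3, map_add, orbit_succ, orbit, jacobi_succ, h2, h1]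
    ring

theorem secondVar_symm (c ξ η : ℕ → Euc d) (n : ℕ) :
    Φ.secondVar c ξ η n = Φ.secondVar c η ξ n :=
  Finset.sum_congr rfl fun _ _ => Φ.hess_symm _ _ _ _

theorem secondVar_congr {c c' ξ ξ' η η' : ℕ → Euc d} {n : ℕ} (hc : ∀ i ≤ n, c i = c' i)
    (hξ : ∀ i ≤ n, ξ i = ξ' i) (hη : ∀ i ≤ n, η i = η' i) :
    Φ.secondVar c ξ η n = Φ.secondVar c' ξ' η' n := by
  refine Finset.sum_congr rfl fun i hi => ?_
  have hi := Finset.mem_range.1 hi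
  rw [hc i hi.le, hc (i + 1) hi, hξ i hi.le, hξ (i + 1) hi, hη i hi.le, hη (i + 1) hi]

theorem secondVar_add_left (c ξ ξ' η : ℕ → Euc d) (n : ℕ) :
    Φ.secondVar c (ξ + ξ') η n = Φ.secondVar c ξ η n + Φ.secondVar c ξ' η n := by
  rw [secondVar, secondVar, secondVar, ← Finset.sum_add_distrib]
  refine Finset.sum_congr rfl fun i _ => ?_
  rw [Pi.add_apply, Pi.add_apply, ← Prod.mk_add_mk, map_add, add_apply]

theorem secondVar_smul_left (c ξ η : ℕ → Euc d) (t : ℝ) (n : ℕ) :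
    Φ.secondVar c (t • ξ) η n = t * Φ.secondVar c ξ η n := by
  rw [secondVar, secondVar, Finset.mul_sum]
  refine Finset.sum_congr rfl fun i _ => ?_
  rw [Pi.smul_apply, Pi.smul_apply, ← Prod.smul_mk, map_smul, smul_apply, smul_eq_mul]

/-- A sequence on which the first variation with fixed ends vanishes is an orbit. -/
theorem exists_orbit_of_firstVar_eq_zero {n : ℕ} {c : ℕ → Euc d}
    (h : ∀ η : ℕ → Euc d, η 0 = 0 → η (n + 1) = 0 → Φ.firstVar c η (n + 1) = 0) :
    ∃ z : CotEuc d, ∀ i ≤ n + 1, Φ.orbit z i = c i := by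
  refine ⟨(c 0, -partialFst Φ.S (c 0) (c 1)), ?_⟩
  set z : CotEuc d := (c 0, -partialFst Φ.S (c 0) (c 1))
  have hstep : ∀ i, Φ.lift (c i, -partialFst Φ.S (c i) (c (i + 1))) =
      (c (i + 1), partialSnd Φ.S (c i) (c (i + 1))) := fun i =>
    (Φ.lift_eq_iff _ _ _ _).2 ⟨rfl, rfl⟩
  have key : ∀ i ≤ n, (Φ.lift ^ i) z = (c i, -partialFst Φ.S (c i) (c (i + 1))) := by
    intro i
    induction i with
    | zero => intro _; rfl
    | succ i ih =>
      intro hi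
      rw [lift_pow_succ_apply, ih (by omega), hstep]
      refine Prod.ext rfl ?_
      ext1 u
      have h1 := h (Pi.single (M := fun _ => Euc d) (i + 1) u)
        (by exact Pi.single_eq_of_ne (by omega) _) (by exact Pi.single_eq_of_ne (by omega) _)
      rw [firstVar, sum_apply_single (by omega)
        (fun i v => fderiv ℝ Φ.S (c i, c (i + 1)) v) (fun i => map_zero _),
        ← partialFst_apply, ← partialSnd_apply] at h1
      rw [neg_apply]
      linarith
  intro i hi
  rcases Nat.lt_or_ge i (n + 1) with h1 | h1
  · rw [orbit, key i (by omega)]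
  · obtain rfl : i = n + 1 := le_antisymm hi h1
    rw [orbit, lift_pow_succ_apply, key n le_rfl, hstep]

/-- A sequence in the kernel of the second variation with fixed ends is a Jacobi field. -/
theorem eq_jacobi_of_secondVar_eq_zero {n : ℕ} {z : CotEuc d} {ξ : ℕ → Euc d} (hξ0 : ξ 0 = 0)
    (h : ∀ η : ℕ → Euc d, η 0 = 0 → η (n + 1) = 0 →
      Φ.secondVar (Φ.orbit z) ξ η (n + 1) = 0) :
    ∃ w : EucDual d, ∀ i ≤ n + 1, (Φ.jacobi z (0, w) i).1 = ξ i := by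
  let c := Φ.orbit z
  let B : ℕ → EucDual d := fun i =>
    -(Φ.hess (c i) (c (i + 1)) (ξ i, ξ (i + 1))).comp (ContinuousLinearMap.inl ℝ (Euc d) (Euc d))
  let B' : ℕ → EucDual d := fun i =>
    (Φ.hess (c i) (c (i + 1)) (ξ i, ξ (i + 1))).comp (ContinuousLinearMap.inr ℝ (Euc d) (Euc d))
  have hstep : ∀ i, fderiv ℝ Φ.lift ((Φ.lift ^ i) z) (ξ i, B i) = (ξ (i + 1), B' i) := by
    intro i
    have h1 : (Φ.lift ((Φ.lift ^ i) z)).1 = c (i + 1) := (Φ.orbit_succ z i).symm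
    refine Φ.fderiv_lift_eq ?_ ?_
    · intro u
      rw [h1]
      simp [B, c, orbit]
    · intro u
      rw [h1]
      simp [B', c, orbit]
  refine ⟨B 0, ?_⟩
  have key : ∀ i ≤ n, Φ.jacobi z (0, B 0) i = (ξ i, B i) := by
    intro i
    induction i with
    | zero => intro _; rw [jacobi_zero, hξ0]
    | succ i ih =>
      intro hi
      rw [jacobi_succ, ih (by omega), hstep]
      refine Prod.ext rfl ?_
      ext1 u
      have h1 := h (Pi.single (M := fun _ => Euc d) (i + 1) u)
        (by exact Pi.single_eq_of_ne (by omega) _) (by exact Pi.single_eq_of_ne (by omega) _)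
      rw [secondVar, sum_apply_single (by omega)
        (fun i v => Φ.hess (Φ.orbit z i) (Φ.orbit z (i + 1)) (ξ i, ξ (i + 1)) v)
        (fun i => map_zero _)] at h1
      simp only [B, B', c, neg_apply, ContinuousLinearMap.comp_apply,
        ContinuousLinearMap.inl_apply, ContinuousLinearMap.inr_apply]
      linarith
  intro i hi
  rcases Nat.lt_or_ge i (n + 1) with h1 | h1
  · rw [key i (by omega)]
  · obtain rfl : i = n + 1 := le_antisymm hi h1
    rw [jacobi_succ, key n le_rfl, hstep]

/-! ### Configurations with fixed ends -/

/-- The coordinates of a variation with fixed ends. -/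
def coord (d m i : ℕ) : (Fin m → Euc d) →L[ℝ] Euc d :=
  if h : 1 ≤ i ∧ i ≤ m then ContinuousLinearMap.proj ⟨i - 1, by omega⟩ else 0

/-- The configuration with interior points `X` and ends `x`, `y`. -/
def config {m : ℕ} (x y : Euc d) (X : Fin m → Euc d) (i : ℕ) : Euc d :=
  (if i = 0 then x else if i ≤ m then 0 else y) + coord d m i X

theorem coord_zero (m : ℕ) : coord d m 0 = 0 := dif_neg (by omega)

theorem coord_last (m : ℕ) : coord d m (m + 1) = 0 := dif_neg (by omega)

theorem coord_restrict {m : ℕ} (η : ℕ → Euc d) {i : ℕ} (hi : 1 ≤ i) (hi' : i ≤ m) :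
    coord d m i (fun j => η (j + 1)) = η i := by
  rw [coord, dif_pos ⟨hi, hi'⟩]
  simp only [ContinuousLinearMap.proj_apply]
  congr 1
  omega

theorem coord_restrict_of_eq_zero {m : ℕ} {η : ℕ → Euc d} (h0 : η 0 = 0) (h1 : η (m + 1) = 0)
    {i : ℕ} (hi : i ≤ m + 1) : coord d m i (fun j => η (j + 1)) = η i := by
  rcases Nat.eq_zero_or_pos i with rfl | hi0
  · rw [coord_zero, h0]; rfl
  rcases Nat.lt_or_ge m i with h | h
  · obtain rfl : i = m + 1 := by omega
    rw [coord_last, h1]; rfl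
  · exact coord_restrict η hi0 h

theorem config_zero {m : ℕ} (x y : Euc d) (X : Fin m → Euc d) : config x y X 0 = x := by
  simp [config, coord_zero]

theorem config_last {m : ℕ} (x y : Euc d) (X : Fin m → Euc d) : config x y X (m + 1) = y := by
  simp [config, coord_last]

theorem config_restrict {m : ℕ} (c : ℕ → Euc d) {i : ℕ} (hi : i ≤ m + 1) :
    config (c 0) (c (m + 1)) (fun j : Fin m => c (j + 1)) i = c i := by
  rcases Nat.eq_zero_or_pos i with rfl | hi0
  · rw [config_zero]
  rcases Nat.lt_or_ge m i with h | h
  · obtain rfl : i = m + 1 := by omega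
    rw [config_last]
  · rw [config, if_neg (by omega), if_pos h, zero_add, coord_restrict c hi0 h]

theorem config_apply_succ {m : ℕ} (x y : Euc d) (X : Fin m → Euc d) (j : Fin m) :
    config x y X (j + 1) = X j := by
  have hj := j.2
  rw [config, if_neg (by omega), if_pos (by omega), zero_add, coord, dif_pos (by omega)]
  rfl

/-- Two consecutive coordinates of a variation. -/
def coordPair (d m i : ℕ) : (Fin m → Euc d) →L[ℝ] Euc d × Euc d :=
  (coord d m i).prod (coord d m (i + 1))

theorem hasFDerivAt_config_pair {m : ℕ} (x y : Euc d) (X : Fin m → Euc d) (i : ℕ) :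
    HasFDerivAt (fun X : Fin m → Euc d => (config x y X i, config x y X (i + 1)))
      (coordPair d m i) X :=
  ((coord d m i).hasFDerivAt.const_add _).prodMk ((coord d m (i + 1)).hasFDerivAt.const_add _)

theorem contDiff_config_pair {m : ℕ} (x y : Euc d) (i : ℕ) :
    ContDiff ℝ 2 (fun X : Fin m → Euc d => (config x y X i, config x y X (i + 1))) :=
  (contDiff_const.add (coord d m i).contDiff).prodMk
    (contDiff_const.add (coord d m (i + 1)).contDiff)

/-- The action of configurations with fixed ends. -/
def endAction (m : ℕ) (x y : Euc d) (X : Fin m → Euc d) : ℝ := Φ.action (config x y X) (m + 1)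

theorem contDiff_endAction (m : ℕ) (x y : Euc d) : ContDiff ℝ 2 (Φ.endAction m x y) :=
  ContDiff.sum (s := Finset.range (m + 1))
    (f := fun i X => Φ.S (config x y X i, config x y X (i + 1)))
    fun i _ => Φ.contDiff.comp (contDiff_config_pair x y i)

theorem fderiv_endAction {m : ℕ} (x y : Euc d) (X : Fin m → Euc d) :
    fderiv ℝ (Φ.endAction m x y) X = ∑ i ∈ Finset.range (m + 1),
      (fderiv ℝ Φ.S (config x y X i, config x y X (i + 1))).comp (coordPair d m i) := by
  have h : HasFDerivAt (Φ.endAction m x y) (∑ i ∈ Finset.range (m + 1),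
      (fderiv ℝ Φ.S (config x y X i, config x y X (i + 1))).comp (coordPair d m i)) X :=
    HasFDerivAt.fun_sum (u := Finset.range (m + 1)) (A := fun i X => Φ.S (config x y X i, config x y X (i + 1)))
      fun i _ => (Φ.hasFDerivAt _).comp X (hasFDerivAt_config_pair x y X i)
  exact h.fderiv

theorem fderiv_endAction_apply {m : ℕ} (x y : Euc d) (X V : Fin m → Euc d) :
    fderiv ℝ (Φ.endAction m x y) X V =
      Φ.firstVar (config x y X) (fun i => coord d m i V) (m + 1) := by
  rw [fderiv_endAction, sum_apply]
  rfl

/-- The second variation along a sequence, as a form on the variations with fixed ends. -/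
def endHess (m : ℕ) (c : ℕ → Euc d) : (Fin m → Euc d) →L[ℝ] (Fin m → Euc d) →L[ℝ] ℝ :=
  ∑ i ∈ Finset.range (m + 1),
    ((ContinuousLinearMap.compL ℝ (Fin m → Euc d) (Euc d × Euc d) ℝ).flip (coordPair d m i)).comp
      ((Φ.hess (c i) (c (i + 1))).comp (coordPair d m i))

theorem endHess_apply (m : ℕ) (c : ℕ → Euc d) (V W : Fin m → Euc d) :
    Φ.endHess m c V W =
      Φ.secondVar c (fun i => coord d m i V) (fun i => coord d m i W) (m + 1) := by
  rw [endHess, sum_apply, sum_apply]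
  rfl

theorem fderiv_fderiv_endAction {m : ℕ} (x y : Euc d) (X : Fin m → Euc d) :
    fderiv ℝ (fderiv ℝ (Φ.endAction m x y)) X = Φ.endHess m (config x y X) := by
  have h1 : fderiv ℝ (Φ.endAction m x y) = fun X => ∑ i ∈ Finset.range (m + 1),
      ((ContinuousLinearMap.compL ℝ (Fin m → Euc d) (Euc d × Euc d) ℝ).flip (coordPair d m i))
        (fderiv ℝ Φ.S (config x y X i, config x y X (i + 1))) := by
    ext1 X
    rw [fderiv_endAction]
    rfl
  have h2 : HasFDerivAt (fderiv ℝ (Φ.endAction m x y)) (Φ.endHess m (config x y X)) X := by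
    rw [h1]
    exact HasFDerivAt.fun_sum fun i _ =>
      (((ContinuousLinearMap.compL ℝ (Fin m → Euc d) (Euc d × Euc d) ℝ).flip
        (coordPair d m i)).hasFDerivAt).comp X
        ((Φ.hasFDerivAt_fderiv _).comp X (hasFDerivAt_config_pair x y X i))
  exact h2.fderiv

theorem norm_config_le {m : ℕ} (c : ℕ → Euc d) :
    ∀ i ≤ m + 1, ‖c i‖ ≤ ‖c 0‖ + ∑ j ∈ Finset.range (m + 1), ‖c (j + 1) - c j‖ := by
  intro i hi
  have h1 : ‖c i‖ ≤ ‖c 0‖ + ∑ j ∈ Finset.range i, ‖c (j + 1) - c j‖ := by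
    have h2 : c i = c 0 + ∑ j ∈ Finset.range i, (c (j + 1) - c j) := by
      rw [Finset.sum_range_sub]; abel
    calc ‖c i‖ = ‖c 0 + ∑ j ∈ Finset.range i, (c (j + 1) - c j)‖ := by rw [← h2]
      _ ≤ _ := (norm_add_le _ _).trans (by gcongr; exact norm_sum_le _ _)
  refine h1.trans ?_
  gcongr

theorem tendsto_endAction (m : ℕ) (x y : Euc d) :
    Tendsto (Φ.endAction m x y) (cocompact (Fin m → Euc d)) atTop := by
  obtain ⟨C, hC⟩ := Φ.exists_norm_sub_le
  have h1 : ∀ X : Fin m → Euc d, ‖X‖ + (-‖x‖ - (m + 1) * C) ≤ Φ.endAction m x y X := by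
    intro X
    set c := config x y X
    have h2 : ∑ j ∈ Finset.range (m + 1), ‖c (j + 1) - c j‖ - (m + 1) * C ≤
        Φ.endAction m x y X := by
      have h3 : ∑ j ∈ Finset.range (m + 1), (‖c (j + 1) - c j‖ - C) ≤ Φ.endAction m x y X :=
        Finset.sum_le_sum fun i _ => hC _ _
      rw [Finset.sum_sub_distrib] at h3
      simpa using h3
    have h4 : ‖X‖ ≤ ‖x‖ + ∑ j ∈ Finset.range (m + 1), ‖c (j + 1) - c j‖ := by
      rw [pi_norm_le_iff_of_nonneg (by positivity)]
      intro j
      have h5 := norm_config_le (m := m) c (j + 1) (by omega)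
      have h6 : c (j + 1) = X j := config_apply_succ x y X j
      have h7 : c 0 = x := config_zero x y X
      rwa [h6, h7] at h5
    linarith
  exact tendsto_atTop_mono h1 (tendsto_atTop_add_const_right _ _ tendsto_norm_cocompact_atTop)

theorem exists_orbit_of_fderiv_endAction_eq_zero {m : ℕ} {x y : Euc d} {X : Fin m → Euc d}
    (hX : fderiv ℝ (Φ.endAction m x y) X = 0) :
    ∃ z : CotEuc d, ∀ i ≤ m + 1, Φ.orbit z i = config x y X i := by
  refine Φ.exists_orbit_of_firstVar_eq_zero fun η h0 h1 => ?_
  have h2 := Φ.fderiv_endAction_apply x y X (fun j => η (j + 1))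
  rw [hX] at h2
  refine Eq.trans (Finset.sum_congr rfl fun i hi => ?_) h2.symm
  have hi := Finset.mem_range.1 hi
  beta_reduce
  rw [coord_restrict_of_eq_zero h0 h1 (by omega), coord_restrict_of_eq_zero h0 h1 (by omega)]

theorem fderiv_endAction_orbit (m : ℕ) (z : CotEuc d) :
    fderiv ℝ (Φ.endAction m z.1 (Φ.orbit z (m + 1))) (fun j => Φ.orbit z (j + 1)) = 0 := by
  ext1 V
  rw [fderiv_endAction_apply]
  have h1 : Φ.firstVar (config z.1 (Φ.orbit z (m + 1)) fun j : Fin m => Φ.orbit z (j + 1))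
      (fun i => coord d m i V) (m + 1) =
      Φ.firstVar (Φ.orbit z) (fun i => coord d m i V) (m + 1) := by
    refine Finset.sum_congr rfl fun i hi => ?_
    have hi := Finset.mem_range.1 hi
    have h2 := config_restrict (m := m) (Φ.orbit z) (i := i) (by omega)
    have h3 := config_restrict (m := m) (Φ.orbit z) (i := i + 1) (by omega)
    rw [orbit_zero] at h2 h3
    rw [h2, h3]
  rw [h1, firstVar_orbit]
  simp [coord_zero, coord_last]

theorem endHess_nondegenerate {Φ : GeneratingFunction d} (hΦ : Φ.WithoutConjugatePoints) (m : ℕ)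
    (z : CotEuc d) {V : Fin m → Euc d} (hV : ∀ W, Φ.endHess m (Φ.orbit z) V W = 0) : V = 0 := by
  obtain ⟨w, hw⟩ := Φ.eq_jacobi_of_secondVar_eq_zero (n := m) (z := z)
    (ξ := fun i => coord d m i V) (by simp [coord_zero]) fun η h0 h1 => by
      have h2 := hV fun j => η (j + 1)
      rw [endHess_apply] at h2
      rw [← h2]
      exact Φ.secondVar_congr (fun _ _ => rfl) (fun _ _ => rfl)
        fun i hi => (coord_restrict_of_eq_zero h0 h1 hi).symm
  have hw0 : w = 0 := by
    refine hΦ.eq_zero (n := m + 1) (by omega) (z := z) ?_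
    have h1 := hw (m + 1) le_rfl
    rw [coord_last] at h1
    exact h1
  ext1 j
  have h1 := hw (j + 1) (by omega)
  rw [hw0] at h1
  have h2 : Φ.jacobi z (0, 0) (j + 1) = 0 := map_zero _
  rw [h2, coord, dif_pos (by omega)] at h1
  exact h1.symm

theorem continuous_orbit (i : ℕ) : Continuous fun z => Φ.orbit z i :=
  continuous_fst.comp (Φ.differentiable_lift_pow i).continuous

theorem continuous_endHess_orbit (m : ℕ) : Continuous fun z => Φ.endHess m (Φ.orbit z) := by
  rw [continuous_clm_apply]
  intro V
  rw [continuous_clm_apply]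
  intro W
  simp_rw [endHess_apply]
  exact continuous_finsetSum _ fun i _ => ((Φ.continuous_hess.comp
    ((Φ.continuous_orbit i).prodMk (Φ.continuous_orbit (i + 1)))).clm_apply
      continuous_const).clm_apply continuous_const

theorem exists_isMin_endAction (m : ℕ) (x y : Euc d) :
    ∃ X, ∀ Y, Φ.endAction m x y X ≤ Φ.endAction m x y Y :=
  (Φ.contDiff_endAction m x y).continuous.exists_forall_le (Φ.tendsto_endAction m x y)

theorem fderiv_endAction_eq_zero_of_isMin {m : ℕ} {x y : Euc d} {X : Fin m → Euc d}
    (hX : ∀ Y, Φ.endAction m x y X ≤ Φ.endAction m x y Y) :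
    fderiv ℝ (Φ.endAction m x y) X = 0 :=
  (show IsLocalMin (Φ.endAction m x y) X from Eventually.of_forall hX).fderiv_eq_zero

theorem endHess_congr {m : ℕ} {c c' : ℕ → Euc d} (h : ∀ i ≤ m + 1, c i = c' i) :
    Φ.endHess m c = Φ.endHess m c' := by
  ext V W
  rw [endHess_apply, endHess_apply]
  exact Φ.secondVar_congr h (fun _ _ => rfl) fun _ _ => rfl

/-- Any two points are joined by an orbit segment of any given length. -/
theorem exists_orbit {n : ℕ} (hn : 0 < n) (x y : Euc d) :
    ∃ p : EucDual d, Φ.orbit (x, p) n = y := by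
  obtain ⟨m, rfl⟩ : ∃ m, n = m + 1 := ⟨n - 1, by omega⟩
  obtain ⟨X, hX⟩ := Φ.exists_isMin_endAction m x y
  obtain ⟨z, hz⟩ :=
    Φ.exists_orbit_of_fderiv_endAction_eq_zero (Φ.fderiv_endAction_eq_zero_of_isMin hX)
  have h0 := hz 0 (by omega)
  have h1 := hz (m + 1) le_rfl
  rw [config_zero] at h0
  rw [config_last] at h1
  rw [orbit_zero] at h0
  refine ⟨z.2, ?_⟩
  rw [← h1, ← h0]

variable {Φ}

namespace WithoutConjugatePoints

theorem endHess_pos (hΦ : Φ.WithoutConjugatePoints) (m : ℕ) (z : CotEuc d) {V : Fin m → Euc d}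
    (hV : V ≠ 0) : 0 < Φ.endHess m (Φ.orbit z) V V := by
  obtain ⟨X, hX⟩ := Φ.exists_isMin_endAction m 0 0
  obtain ⟨z₀, hz₀⟩ :=
    Φ.exists_orbit_of_fderiv_endAction_eq_zero (Φ.fderiv_endAction_eq_zero_of_isMin hX)
  refine pos_of_nondegenerate_of_preconnected (Φ.continuous_endHess_orbit m) (fun z v w => ?_)
    (fun z v hv => endHess_nondegenerate hΦ m z hv) (z₀ := z₀) (fun v => ?_) z hV
  · rw [endHess_apply, endHess_apply, secondVar_symm]
  · rw [Φ.endHess_congr hz₀, ← fderiv_fderiv_endAction]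
    exact nonneg_fderiv_fderiv_of_isMin (Φ.contDiff_endAction m 0 0) hX v

theorem secondVar_nonneg (hΦ : Φ.WithoutConjugatePoints) {n : ℕ} (hn : 0 < n) (z : CotEuc d)
    {ξ : ℕ → Euc d} (h0 : ξ 0 = 0) (h1 : ξ n = 0) : 0 ≤ Φ.secondVar (Φ.orbit z) ξ ξ n := by
  obtain ⟨m, rfl⟩ : ∃ m, n = m + 1 := ⟨n - 1, by omega⟩
  have h2 : 0 ≤ Φ.endHess m (Φ.orbit z) (fun j => ξ (j + 1)) (fun j => ξ (j + 1)) := by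
    by_cases hV : (fun j : Fin m => ξ (j + 1)) = 0
    · rw [hV]; simp
    · exact (hΦ.endHess_pos m z hV).le
  rw [endHess_apply] at h2
  refine h2.trans (le_of_eq (Φ.secondVar_congr (fun _ _ => rfl)
    (fun i hi => ?_) (fun i hi => ?_))) <;> exact coord_restrict_of_eq_zero h0 h1 hi

/-- Critical configurations with given ends are unique. -/
theorem critical_unique (hΦ : Φ.WithoutConjugatePoints) {m : ℕ} {x y : Euc d}
    {X Y : Fin m → Euc d} (hX : fderiv ℝ (Φ.endAction m x y) X = 0)
    (hY : fderiv ℝ (Φ.endAction m x y) Y = 0) : X = Y := by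
  refine eq_of_fderiv_eq_zero_of_coercive' (Φ.contDiff_endAction m x y) (Φ.tendsto_endAction m x y)
    (fun Z hZ V hV => ?_) hX hY
  obtain ⟨z, hz⟩ := Φ.exists_orbit_of_fderiv_endAction_eq_zero hZ
  rw [fderiv_fderiv_endAction, ← Φ.endHess_congr hz]
  exact hΦ.endHess_pos m z hV

/-- Orbit segments minimize the action between their ends. -/
theorem action_orbit_le (hΦ : Φ.WithoutConjugatePoints) {n : ℕ} (hn : 0 < n) (z : CotEuc d)
    {c : ℕ → Euc d} (h0 : c 0 = z.1) (h1 : c n = Φ.orbit z n) :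
    Φ.action (Φ.orbit z) n ≤ Φ.action c n := by
  obtain ⟨m, rfl⟩ : ∃ m, n = m + 1 := ⟨n - 1, by omega⟩
  obtain ⟨X, hX⟩ := Φ.exists_isMin_endAction m z.1 (Φ.orbit z (m + 1))
  have h2 := hΦ.critical_unique (Φ.fderiv_endAction_eq_zero_of_isMin hX)
    (Φ.fderiv_endAction_orbit m z)
  have h3 : ∀ c' : ℕ → Euc d, c' 0 = z.1 → c' (m + 1) = Φ.orbit z (m + 1) →
      Φ.endAction m z.1 (Φ.orbit z (m + 1)) (fun j : Fin m => c' (j + 1)) = Φ.action c' (m + 1) := by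
    intro c' h0' h1'
    rw [endAction, action, action]
    refine Finset.sum_congr rfl fun i hi => ?_
    have hi := Finset.mem_range.1 hi
    rw [← h0', ← h1', config_restrict c' (by omega), config_restrict c' (by omega)]
  have h4 := hX fun j : Fin m => c (j + 1)
  rw [h2, h3 c h0 h1, h3 (Φ.orbit z) rfl rfl] at h4
  exact h4

theorem orbit_unique (hΦ : Φ.WithoutConjugatePoints) {n : ℕ} (hn : 0 < n) {x : Euc d}
    {p q : EucDual d} (h : Φ.orbit (x, p) n = Φ.orbit (x, q) n) : p = q := by
  obtain ⟨m, rfl⟩ : ∃ m, n = m + 1 := ⟨n - 1, by omega⟩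
  have h1 := Φ.fderiv_endAction_orbit m (x, p)
  have h2 := Φ.fderiv_endAction_orbit m (x, q)
  rw [h] at h1
  have h3 := hΦ.critical_unique h1 h2
  have h4 : Φ.orbit (x, p) 1 = Φ.orbit (x, q) 1 := by
    rcases Nat.eq_zero_or_pos m with rfl | hm
    · exact h
    · exact congrFun h3 ⟨0, hm⟩
  have h5 := Φ.lift_momentum (x, p)
  have h6 := Φ.lift_momentum (x, q)
  have h7 : (Φ.lift (x, p)).1 = (Φ.lift (x, q)).1 := h4
  rw [h7] at h5
  exact h5.trans h6.symm

end WithoutConjugatePoints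

end GeneratingFunction

namespace GeneratingFunction

variable {d : ℕ} (Φ : GeneratingFunction d)

/-! ### Orbits with prescribed ends -/

theorem lift_pow_add (n : ℕ) (s : Fin d → ℤ) (x : Euc d) (p : EucDual d) :
    (Φ.lift ^ n) (x + intVec s, p) =
      (((Φ.lift ^ n) (x, p)).1 + intVec s, ((Φ.lift ^ n) (x, p)).2) := by
  induction n with
  | zero => rfl
  | succ n ih => rw [lift_pow_succ_apply, ih, lift_add, lift_pow_succ_apply]

theorem orbit_add (n : ℕ) (s : Fin d → ℤ) (x : Euc d) (p : EucDual d) :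
    Φ.orbit (x + intVec s, p) n = Φ.orbit (x, p) n + intVec s := by
  rw [orbit, lift_pow_add]; rfl

/-- The initial momentum of the orbit from `x` to `y` in `n` steps is as smooth as the twist map. -/
theorem contDiff_endMomentum {Φ : GeneratingFunction d} (hΦ : Φ.WithoutConjugatePoints) {n : ℕ}
    (hn : 0 < n) {k : WithTop ℕ∞} (hk : 1 ≤ k) (hF : ContDiff ℝ k Φ.lift)
    {q : Euc d × Euc d → EucDual d} (hq : ∀ z, Φ.orbit (z.1, q z) n = z.2) : ContDiff ℝ k q := by
  have hk0 : k ≠ 0 := fun h => by simp [h] at hk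
  have h1 : ContDiff ℝ k fun z : Euc d × Euc d => (z.1, q z) := by
    refine contDiff_of_inverse (f := fun z : CotEuc d => (z.1, Φ.orbit z n)) hk0
      (contDiff_fst.prodMk (contDiff_fst.comp (Φ.contDiff_lift_pow hF n))) ?_ ?_ ?_ ?_
    · rintro ⟨x, p⟩
      exact Prod.ext rfl (hΦ.orbit_unique hn (hq _))
    · intro z
      exact Prod.ext rfl (hq z)
    · intro z
      have hd : HasFDerivAt (fun z : CotEuc d => (z.1, Φ.orbit z n)) _ z :=
        (hasFDerivAt_fst (𝕜 := ℝ) (p := z)).prodMk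
          (hasFDerivAt_fst.comp z (Φ.differentiable_lift_pow n z).hasFDerivAt)
      rw [hd.fderiv, injective_iff_map_eq_zero]
      rintro ⟨ξ, w⟩ h
      simp only [ContinuousLinearMap.prod_apply, Prod.mk_eq_zero] at h
      obtain ⟨h, h'⟩ := h
      have hξ : ξ = 0 := h
      subst hξ
      rw [hΦ.eq_zero hn h']; rfl
    · rw [Module.finrank_prod, Module.finrank_prod]
      congr 1
      exact (InnerProductSpace.toDual ℝ (Euc d)).toLinearEquiv.finrank_eq.symm
  exact contDiff_snd.comp h1

/-! ### Orbits that return to an integer translate of their starting point -/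

section Return

variable {Φ} {N : ℕ} {r : Fin d → ℤ} {p : Euc d → EucDual d}

theorem contDiff_returnMomentum (hΦ : Φ.WithoutConjugatePoints) (hN : 0 < N)
    (hp : ∀ x, Φ.orbit (x, p x) N = x + intVec r) {k : WithTop ℕ∞} (hk : 1 ≤ k)
    (hF : ContDiff ℝ k Φ.lift) : ContDiff ℝ k p := by
  choose q hq using fun z : Euc d × Euc d => Φ.exists_orbit hN z.1 z.2
  have h1 : p = fun x => q (x, x + intVec r) := by
    ext1 x
    exact hΦ.orbit_unique hN ((hp x).trans (hq (x, x + intVec r)).symm)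
  rw [h1]
  exact (contDiff_endMomentum hΦ hN hk hF hq).comp
    (contDiff_id.prodMk (contDiff_id.add contDiff_const))

theorem returnMomentum_add (hΦ : Φ.WithoutConjugatePoints) (hN : 0 < N)
    (hp : ∀ x, Φ.orbit (x, p x) N = x + intVec r) (s : Fin d → ℤ) (x : Euc d) :
    p (x + intVec s) = p x := by
  refine hΦ.orbit_unique hN (x := x + intVec s) ?_
  rw [hp, orbit_add, hp]
  abel

theorem returnAction_add (hΦ : Φ.WithoutConjugatePoints) (hN : 0 < N)
    (hp : ∀ x, Φ.orbit (x, p x) N = x + intVec r) (s : Fin d → ℤ) (x : Euc d) :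
    Φ.action (Φ.orbit (x + intVec s, p (x + intVec s))) N = Φ.action (Φ.orbit (x, p x)) N := by
  refine Finset.sum_congr rfl fun i _ => ?_
  rw [returnMomentum_add hΦ hN hp, orbit_add, orbit_add, Φ.periodic]

theorem hasFDerivAt_returnAction (hp : ∀ x, Φ.orbit (x, p x) N = x + intVec r)
    (hd : Differentiable ℝ p) (x : Euc d) :
    HasFDerivAt (fun x => Φ.action (Φ.orbit (x, p x)) N) (((Φ.lift ^ N) (x, p x)).2 - p x) x := by
  have h1 : ∀ i, Differentiable ℝ fun x => Φ.orbit (x, p x) i := fun i =>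
    differentiable_fst.comp ((Φ.differentiable_lift_pow i).comp (differentiable_id.prodMk hd))
  have h2 : ∀ i, HasFDerivAt (fun x => Φ.S (Φ.orbit (x, p x) i, Φ.orbit (x, p x) (i + 1)))
      ((fderiv ℝ Φ.S (Φ.orbit (x, p x) i, Φ.orbit (x, p x) (i + 1))).comp
        ((fderiv ℝ (fun x => Φ.orbit (x, p x) i) x).prod
          (fderiv ℝ (fun x => Φ.orbit (x, p x) (i + 1)) x))) x := fun i =>
    HasFDerivAt.comp (f := fun x => (Φ.orbit (x, p x) i, Φ.orbit (x, p x) (i + 1))) x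
      (Φ.hasFDerivAt _) ((h1 i x).hasFDerivAt.prodMk (h1 (i + 1) x).hasFDerivAt)
  have h3 := HasFDerivAt.fun_sum (u := Finset.range N) fun i _ => h2 i
  refine h3.congr_fderiv ?_
  ext1 v
  have h4 := Φ.firstVar_orbit (x, p x) (fun i => fderiv ℝ (fun x => Φ.orbit (x, p x) i) x v) N
  have h5 : fderiv ℝ (fun x => Φ.orbit (x, p x) N) x = ContinuousLinearMap.id ℝ (Euc d) := by
    rw [funext hp]
    exact ((hasFDerivAt_id x).add_const _).fderiv
  have h6 : fderiv ℝ (fun x => Φ.orbit (x, p x) 0) x = ContinuousLinearMap.id ℝ (Euc d) :=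
    (hasFDerivAt_id x).fderiv
  beta_reduce at h4
  rw [h5, h6] at h4
  rw [sum_apply, sub_apply]
  exact h4

/-- Orbits that close up modulo a translation. -/
theorem orbit_add_mul {z : CotEuc d} (hz : (Φ.lift ^ N) z = (z.1 + intVec r, z.2)) (k i : ℕ) :
    Φ.orbit z (k * N + i) = Φ.orbit z i + intVec (k • r) := by
  induction k with
  | zero => simp
  | succ k ih =>
    have h1 : (k + 1) * N + i = (k * N + i) + N := by ring
    rw [h1, orbit, pow_add, Equiv.Perm.mul_apply, hz, lift_pow_add]
    change Φ.orbit z (k * N + i) + intVec r = _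
    rw [ih, add_assoc, ← map_add, succ_nsmul]

theorem action_mul {z : CotEuc d} (hz : (Φ.lift ^ N) z = (z.1 + intVec r, z.2)) (k : ℕ) :
    Φ.action (Φ.orbit z) (k * N) = k * Φ.action (Φ.orbit z) N := by
  induction k with
  | zero => simp [action]
  | succ k ih =>
    rw [action, Nat.succ_mul, Finset.sum_range_add, ← action, ih]
    have h1 : ∑ i ∈ Finset.range N, Φ.S (Φ.orbit z (k * N + i), Φ.orbit z (k * N + i + 1)) =
        Φ.action (Φ.orbit z) N := by
      refine Finset.sum_congr rfl fun i _ => ?_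
      rw [add_assoc, orbit_add_mul hz, orbit_add_mul hz, Φ.periodic]
    rw [h1]
    push_cast
    ring

/-- The effect on the action of moving the two ends of a sequence. -/
theorem exists_action_move_ends (Φ : GeneratingFunction d) (c : ℕ → Euc d) (a b : Euc d) (m : ℕ) :
    ∃ c' : ℕ → Euc d, c' 0 = a ∧ c' (m + 2) = b ∧ Φ.action c' (m + 2) =
      Φ.action c (m + 2) + (Φ.S (a, c 1) - Φ.S (c 0, c 1)) +
        (Φ.S (c (m + 1), b) - Φ.S (c (m + 1), c (m + 2))) := by
  refine ⟨fun i => if i = 0 then a else if i = m + 2 then b else c i, by simp, by simp, ?_⟩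
  simp only [action]
  rw [Finset.sum_range_succ, Finset.sum_range_succ', Finset.sum_range_succ (n := m + 1),
    Finset.sum_range_succ' (n := m)]
  have h1 : ∑ k ∈ Finset.range m, Φ.S ((if k + 1 = 0 then a else if k + 1 = m + 2 then b
      else c (k + 1)), if k + 1 + 1 = 0 then a else if k + 1 + 1 = m + 2 then b
      else c (k + 1 + 1)) = ∑ k ∈ Finset.range m, Φ.S (c (k + 1), c (k + 1 + 1)) := by
    refine Finset.sum_congr rfl fun k hk => ?_
    have hk := Finset.mem_range.1 hk
    rw [if_neg (by omega), if_neg (by omega), if_neg (by omega), if_neg (by omega)]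
  rw [h1]
  simp
  ring

theorem action_le_of_periodic (hΦ : Φ.WithoutConjugatePoints) (hN : 0 < N) {z z' : CotEuc d}
    (hz : (Φ.lift ^ N) z = (z.1 + intVec r, z.2)) (hz' : (Φ.lift ^ N) z' = (z'.1 + intVec r, z'.2)) :
    Φ.action (Φ.orbit z) N ≤ Φ.action (Φ.orbit z') N := by
  obtain ⟨M, rfl⟩ : ∃ M, N = M + 1 := ⟨N - 1, by omega⟩
  set C := (Φ.S (z.1, Φ.orbit z' 1) - Φ.S (z'.1, Φ.orbit z' 1)) +
    (Φ.S (Φ.orbit z' M, z.1 + intVec r) - Φ.S (Φ.orbit z' M, z'.1 + intVec r)) with hC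
  have key : ∀ k : ℕ, ((k + 2 : ℕ) : ℝ) *
      (Φ.action (Φ.orbit z) (M + 1) - Φ.action (Φ.orbit z') (M + 1)) ≤ C := by
    intro k
    have h0 : (k + 1) * (M + 1) + M + 1 = (k + 2) * (M + 1) := by ring
    obtain ⟨m, hm⟩ : ∃ m, (k + 1) * (M + 1) + M = m + 1 :=
      ⟨(k + 1) * M + k + M, by ring⟩
    have hm2 : (k + 2) * (M + 1) = m + 2 := by omega
    obtain ⟨c', hc0, hc1, hc⟩ := exists_action_move_ends Φ (Φ.orbit z') z.1
      (z.1 + intVec ((k + 2) • r)) m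
    have e1 : ∀ y : CotEuc d, (Φ.lift ^ (M + 1)) y = (y.1 + intVec r, y.2) →
        Φ.orbit y (m + 2) = y.1 + intVec ((k + 2) • r) := by
      intro y hy
      rw [← hm2]
      exact orbit_add_mul hy (k + 2) 0
    have e2 : Φ.orbit z' (m + 1) = Φ.orbit z' M + intVec ((k + 1) • r) := by
      rw [← hm]
      exact orbit_add_mul hz' (k + 1) M
    have e3 : ∀ y : Euc d, Φ.S (Φ.orbit z' (m + 1), y + intVec ((k + 2) • r)) =
        Φ.S (Φ.orbit z' M, y + intVec r) := by
      intro y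
      have h : intVec ((k + 2) • r) = intVec r + intVec ((k + 1) • r) := by
        rw [← map_add, ← succ_nsmul']
      rw [e2, h, ← add_assoc, Φ.periodic]
    have h1 := hΦ.action_orbit_le (n := m + 2) (by omega) z hc0 (hc1.trans (e1 z hz).symm)
    rw [hc, e1 z' hz', e3, e3, orbit_zero] at h1
    have h2 := action_mul hz (k + 2)
    have h3 := action_mul hz' (k + 2)
    rw [hm2] at h2 h3
    rw [h2, h3] at h1
    rw [mul_sub]
    linarith
  by_contra! hlt
  obtain ⟨k, hk⟩ := exists_nat_gt
    (C / (Φ.action (Φ.orbit z) (M + 1) - Φ.action (Φ.orbit z') (M + 1)))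
  rw [div_lt_iff₀ (sub_pos.2 hlt)] at hk
  have h1 := key k
  push_cast at h1
  nlinarith

/-- All orbits that return to a translate of their starting point also return with the same
momentum. -/
theorem lift_pow_returnMomentum (hΦ : Φ.WithoutConjugatePoints) (hN : 0 < N)
    (hp : ∀ x, Φ.orbit (x, p x) N = x + intVec r) (x : Euc d) :
    (Φ.lift ^ N) (x, p x) = (x + intVec r, p x) := by
  have hd : Differentiable ℝ p :=
    (contDiff_returnMomentum hΦ hN hp le_rfl Φ.contDiff_one_lift).differentiable (by norm_num)
  set φ : Euc d → ℝ := fun x => Φ.action (Φ.orbit (x, p x)) N with hφ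
  have hφd : ∀ x, HasFDerivAt φ (((Φ.lift ^ N) (x, p x)).2 - p x) x :=
    hasFDerivAt_returnAction hp hd
  have hcrit : ∀ x, fderiv ℝ φ x = 0 → (Φ.lift ^ N) (x, p x) = (x + intVec r, p x) := by
    intro x hx
    rw [(hφd x).fderiv, sub_eq_zero] at hx
    exact Prod.ext (hp x) hx
  have hφc : Continuous φ := continuous_iff_continuousAt.2 fun x => (hφd x).continuousAt
  have hper : ∀ (s : Fin d → ℤ) x, φ (x + intVec s) = φ x := returnAction_add hΦ hN hp
  obtain ⟨x₁, h₁⟩ := exists_forall_le_of_periodic hφc hper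
  obtain ⟨x₀, h₀⟩ := exists_forall_le_of_periodic (f := fun x => -φ x) hφc.neg
    fun s x => by rw [hper]
  have hmax : IsLocalMax φ x₁ := Eventually.of_forall h₁
  have hmin : IsLocalMin φ x₀ := Eventually.of_forall fun x => neg_le_neg_iff.1 (h₀ x)
  have hle := action_le_of_periodic hΦ hN (z := (x₁, p x₁)) (z' := (x₀, p x₀))
    (hcrit x₁ hmax.fderiv_eq_zero) (hcrit x₀ hmin.fderiv_eq_zero)
  have hconst : φ = fun _ => φ x₁ := by
    ext1 x
    exact le_antisymm (h₁ x) (hle.trans (neg_le_neg_iff.1 (h₀ x)))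
  refine hcrit x ?_
  rw [hconst]
  exact fderiv_const_apply _

/-- The periodic set is the graph of the momentum of return. -/
theorem cotMk_mem_periodicSet_iff (hΦ : Φ.WithoutConjugatePoints) (hN : 0 < N)
    (hp : ∀ x, Φ.orbit (x, p x) N = x + intVec r) (z : CotEuc d) :
    cotMk z ∈ Φ.periodicSet N r ↔ z.2 = p z.1 := by
  constructor
  · rintro ⟨⟨x, q⟩, hy, hyz⟩
    obtain ⟨x', q'⟩ := z
    simp only [cotMk, Prod.mk.injEq] at hyz
    obtain ⟨h1, rfl⟩ := hyz
    obtain ⟨s, rfl⟩ := torusMk_eq_iff.1 h1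
    change q = p (x + intVec s)
    rw [returnMomentum_add hΦ hN hp]
    refine hΦ.orbit_unique hN (x := x) ?_
    rw [hp]
    exact congrArg Prod.fst hy
  · intro h
    refine ⟨z, ?_, rfl⟩
    have h1 := lift_pow_returnMomentum hΦ hN hp z.1
    rw [← h] at h1
    exact h1

end Return

end GeneratingFunction

namespace GeneratingFunction

variable {d : ℕ} (Φ : GeneratingFunction d)

/-! ### The Green bundle along an orbit -/

/-- The point of the orbit of `z` at time `-n`. -/
def back (z : CotEuc d) (n : ℕ) : CotEuc d := (Φ.lift ^ n)⁻¹ z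

theorem lift_pow_back (z : CotEuc d) (n : ℕ) : (Φ.lift ^ n) (Φ.back z n) = z :=
  Equiv.apply_symm_apply _ z

theorem lift_back_succ (z : CotEuc d) (n : ℕ) : Φ.lift (Φ.back z (n + 1)) = Φ.back z n := by
  refine (Φ.lift ^ n).injective ?_
  rw [lift_pow_back, ← Equiv.Perm.mul_apply, ← pow_succ, lift_pow_back]

theorem orbit_back_succ (z : CotEuc d) (n i : ℕ) :
    Φ.orbit (Φ.back z (n + 1)) (i + 1) = Φ.orbit (Φ.back z n) i := by
  rw [orbit, pow_succ, Equiv.Perm.mul_apply, lift_back_succ, orbit]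

theorem orbit_back_self (z : CotEuc d) (n i : ℕ) :
    Φ.orbit (Φ.back z n) (n + i) = Φ.orbit z i := by
  rw [orbit, add_comm, pow_add, Equiv.Perm.mul_apply, lift_pow_back, orbit]

theorem secondVar_add_smul (c ξ η : ℕ → Euc d) (t : ℝ) (n : ℕ) :
    Φ.secondVar c (ξ + t • η) (ξ + t • η) n =
      Φ.secondVar c ξ ξ n + 2 * t * Φ.secondVar c ξ η n + t ^ 2 * Φ.secondVar c η η n := by
  rw [secondVar_add_left, secondVar_smul_left, secondVar_symm, secondVar_add_left,
    secondVar_smul_left, Φ.secondVar_symm c η (ξ + t • η), secondVar_add_left,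
    secondVar_smul_left, Φ.secondVar_symm c η ξ]
  ring

/-- The orbit of a point that returns to a translate of itself is periodic up to translations. -/
theorem lift_pow_mul {z : CotEuc d} {N : ℕ} {r : Fin d → ℤ}
    (hz : (Φ.lift ^ N) z = (z.1 + intVec r, z.2)) (k : ℕ) :
    (Φ.lift ^ (k * N)) z = (z.1 + intVec (k • r), z.2) := by
  induction k with
  | zero => simp
  | succ k ih =>
    rw [Nat.succ_mul, pow_add, Equiv.Perm.mul_apply, hz, lift_pow_add, ih, add_assoc, ← map_add,
      succ_nsmul]

theorem back_mul_add {z : CotEuc d} {N : ℕ} {r : Fin d → ℤ}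
    (hz : (Φ.lift ^ N) z = (z.1 + intVec r, z.2)) (k n : ℕ) :
    Φ.back z (k * N + n) = ((Φ.back z n).1 + intVec (-(k • r)), (Φ.back z n).2) := by
  refine (Φ.lift ^ (k * N + n)).injective ?_
  rw [lift_pow_back, pow_add, Equiv.Perm.mul_apply, lift_pow_add, lift_pow_back, lift_pow_add,
    lift_pow_mul Φ hz, add_assoc, ← map_add, add_neg_cancel, map_zero, add_zero]

variable {Φ}

/-- The image of the vertical space after `n` steps is the graph of a linear map. -/
theorem exists_slope (hΦ : Φ.WithoutConjugatePoints) (z : CotEuc d) (n : ℕ) :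
    ∃ s W : Euc d →ₗ[ℝ] EucDual d, 0 < n → ∀ y, Φ.jacobi z (0, W y) n = (y, s y) := by
  rcases Nat.eq_zero_or_pos n with rfl | hn
  · exact ⟨0, 0, fun h => absurd h (lt_irrefl 0)⟩
  let L : EucDual d →ₗ[ℝ] CotEuc d :=
    (fderiv ℝ (Φ.lift ^ n : Equiv.Perm (CotEuc d)) z).toLinearMap ∘ₗ
      LinearMap.inr ℝ (Euc d) (EucDual d)
  let A : EucDual d →ₗ[ℝ] Euc d := LinearMap.fst ℝ (Euc d) (EucDual d) ∘ₗ L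
  have hA : Function.Injective A := by
    rw [injective_iff_map_eq_zero]
    exact fun w hw => hΦ.eq_zero hn hw
  let e : EucDual d ≃ₗ[ℝ] Euc d := LinearEquiv.ofInjectiveOfFinrankEq A hA
    (InnerProductSpace.toDual ℝ (Euc d)).toLinearEquiv.finrank_eq.symm
  refine ⟨LinearMap.snd ℝ (Euc d) (EucDual d) ∘ₗ L ∘ₗ e.symm.toLinearMap, e.symm.toLinearMap,
    fun _ y => Prod.ext ?_ rfl⟩
  exact e.apply_symm_apply y

section Slope

variable {z : CotEuc d} {s W : ℕ → Euc d →ₗ[ℝ] EucDual d}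

theorem secondVar_slope {n : ℕ} (hn : 0 < n)
    (hs : ∀ n, 0 < n → ∀ y, Φ.jacobi (Φ.back z n) (0, W n y) n = (y, s n y)) (y : Euc d)
    (η : ℕ → Euc d) : Φ.secondVar (Φ.orbit (Φ.back z n))
      (fun i => (Φ.jacobi (Φ.back z n) (0, W n y) i).1) η n = s n y (η n) - W n y (η 0) := by
  rw [secondVar_jacobi, hs n hn]

theorem slope_symm {n : ℕ} (hn : 0 < n)
    (hs : ∀ n, 0 < n → ∀ y, Φ.jacobi (Φ.back z n) (0, W n y) n = (y, s n y)) (y u : Euc d) :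
    s n y u = s n u y := by
  have h1 := secondVar_slope hn hs y (fun i => (Φ.jacobi (Φ.back z n) (0, W n u) i).1)
  have h2 := secondVar_slope hn hs u (fun i => (Φ.jacobi (Φ.back z n) (0, W n y) i).1)
  rw [secondVar_symm, h2] at h1
  simp only [jacobi_zero, hs n hn, map_zero, sub_zero] at h1
  exact h1.symm

theorem slope_le_secondVar (hΦ : Φ.WithoutConjugatePoints) {n : ℕ} (hn : 0 < n)
    (hs : ∀ n, 0 < n → ∀ y, Φ.jacobi (Φ.back z n) (0, W n y) n = (y, s n y)) {y : Euc d}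
    {ζ : ℕ → Euc d} (h0 : ζ 0 = 0) (h1 : ζ n = y) :
    s n y y ≤ Φ.secondVar (Φ.orbit (Φ.back z n)) ζ ζ n := by
  set η : ℕ → Euc d := fun i => (Φ.jacobi (Φ.back z n) (0, W n y) i).1 with hη
  have hη0 : η 0 = 0 := by simp [hη]
  have hηn : η n = y := by simp [hη, hs n hn]
  have h2 := hΦ.secondVar_nonneg hn (Φ.back z n) (ξ := ζ + (-1 : ℝ) • η) (by simp [h0, hη0])
    (by simp [h1, hηn])
  have h3 := secondVar_slope hn hs y ζ
  have h4 := secondVar_slope hn hs y η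
  rw [secondVar_add_smul, secondVar_symm _ _ ζ η] at h2
  rw [← hη, h0, h1, map_zero, sub_zero] at h3
  rw [← hη, hη0, hηn, map_zero, sub_zero] at h4
  rw [h3, h4] at h2
  linarith

theorem slope_succ_le (hΦ : Φ.WithoutConjugatePoints) {n : ℕ} (hn : 0 < n)
    (hs : ∀ n, 0 < n → ∀ y, Φ.jacobi (Φ.back z n) (0, W n y) n = (y, s n y)) (y u : Euc d)
    (ε : ℝ) : s (n + 1) y y ≤ s n y y - 2 * ε * W n y u + ε ^ 2 *
      (Φ.hess (Φ.back z (n + 1)).1 (Φ.back z n).1 (0, u) (0, u) +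
        Φ.hess (Φ.back z n).1 (Φ.orbit (Φ.back z n) 1) (u, 0) (u, 0)) := by
  set η : ℕ → Euc d := fun i => (Φ.jacobi (Φ.back z n) (0, W n y) i).1 with hη
  have hη0 : η 0 = 0 := by simp [hη]
  have hηn : η n = y := by simp [hη, hs n hn]
  set ρ : ℕ → Euc d := fun i => if i = 0 then u else 0 with hρ
  let ζ : ℕ → Euc d := fun i => if i = 0 then 0 else (η + ε • ρ) (i - 1)
  have h1 := slope_le_secondVar hΦ (n := n + 1) (by omega) hs (y := y) (ζ := ζ) rfl (by
    change (η + ε • ρ) n = y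
    simp [hρ, hηn, hn.ne'])
  have h2 : Φ.secondVar (Φ.orbit (Φ.back z (n + 1))) ζ ζ (n + 1) =
      Φ.secondVar (Φ.orbit (Φ.back z n)) (η + ε • ρ) (η + ε • ρ) n +
        Φ.hess (Φ.back z (n + 1)).1 (Φ.back z n).1 (0, ε • u) (0, ε • u) := by
    rw [secondVar, Finset.sum_range_succ', orbit_back_succ]
    congr 1
    · refine Finset.sum_congr rfl fun i _ => ?_
      rw [orbit_back_succ, orbit_back_succ]
      rfl
    · have : ζ (0 + 1) = ε • u := by
        change (η + ε • ρ) 0 = _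
        simp [hη0, hρ]
      rw [this]
      rfl
  have h3 := secondVar_slope hn hs y ρ
  have h4 := secondVar_slope hn hs y η
  rw [← hη] at h3 h4
  rw [hη0, hηn, map_zero, sub_zero] at h4
  have h5 : ρ n = 0 := if_neg hn.ne'
  have h6 : ρ 0 = u := rfl
  rw [h5, h6, map_zero, zero_sub] at h3
  have h7 : Φ.secondVar (Φ.orbit (Φ.back z n)) ρ ρ n =
      Φ.hess (Φ.back z n).1 (Φ.orbit (Φ.back z n) 1) (u, 0) (u, 0) := by
    rw [secondVar, Finset.sum_eq_single_of_mem 0 (Finset.mem_range.2 hn)]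
    · rfl
    · intro i _ hi
      have : (ρ i, ρ (i + 1)) = 0 := by simp [hρ, hi]
      rw [this, map_zero]
  have h8 : ((0 : Euc d), ε • u) = ε • ((0 : Euc d), u) := by simp
  rw [h2, secondVar_add_smul, h3, h4, h7, h8, map_smul, map_smul, smul_apply,
    smul_eq_mul, smul_eq_mul] at h1
  linarith

theorem neg_hess_le_slope (hΦ : Φ.WithoutConjugatePoints) {n : ℕ} (hn : 0 < n)
    (hs : ∀ n, 0 < n → ∀ y, Φ.jacobi (Φ.back z n) (0, W n y) n = (y, s n y)) (y : Euc d) :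
    -Φ.hess z.1 (Φ.orbit z 1) (y, 0) (y, 0) ≤ s n y y := by
  set η : ℕ → Euc d := fun i => (Φ.jacobi (Φ.back z n) (0, W n y) i).1 with hη
  have hη0 : η 0 = 0 := by simp [hη]
  have hηn : η n = y := by simp [hη, hs n hn]
  let ζ : ℕ → Euc d := fun i => if i = n + 1 then 0 else η i
  have hζ : ∀ i ≤ n, ζ i = η i := fun i hi => if_neg (by omega)
  have h1 := hΦ.secondVar_nonneg (n := n + 1) (by omega) (Φ.back z n) (ξ := ζ)
    ((hζ 0 (by omega)).trans hη0) (if_pos rfl)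
  have h2 := secondVar_slope hn hs y η
  rw [← hη, hη0, hηn, map_zero, sub_zero] at h2
  have h3 := Φ.orbit_back_self z n 0
  rw [secondVar, Finset.sum_range_succ, ← secondVar, orbit_back_self, hζ n le_rfl, hηn,
    show ζ (n + 1) = 0 from if_pos rfl, Φ.secondVar_congr (fun _ _ => rfl) hζ hζ, h2] at h1
  rw [add_zero] at h3
  rw [h3, orbit_zero] at h1
  linarith

theorem exists_tendsto_slope (hΦ : Φ.WithoutConjugatePoints)
    (hs : ∀ n, 0 < n → ∀ y, Φ.jacobi (Φ.back z n) (0, W n y) n = (y, s n y)) (y u : Euc d) :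
    ∃ l, Tendsto (fun n => s n y u) atTop (𝓝 l) := by
  have h1 : ∀ y, ∃ l, Tendsto (fun n => s n y y) atTop (𝓝 l) := by
    intro y
    have hanti : Antitone fun n => s (n + 1) y y := antitone_nat_of_succ_le fun n => by
      simpa using slope_succ_le hΦ (n := n + 1) (by omega) hs y 0 0
    have hbdd : BddBelow (range fun n => s (n + 1) y y) :=
      ⟨_, by rintro _ ⟨n, rfl⟩; exact neg_hess_le_slope hΦ (by omega) hs y⟩
    exact ⟨_, (tendsto_add_atTop_iff_nat 1).1 (tendsto_atTop_ciInf hanti hbdd)⟩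
  obtain ⟨a, ha⟩ := h1 (y + u)
  obtain ⟨b, hb⟩ := h1 y
  obtain ⟨c, hc⟩ := h1 u
  refine ⟨(a - b - c) / 2, (((ha.sub hb).sub hc).div_const 2).congr' ?_⟩
  filter_upwards [eventually_gt_atTop 0] with n hn
  have := slope_symm hn hs y u
  simp only [map_add, add_apply]
  rw [this]
  ring

/-- Along a periodic orbit the initial momenta of the fields that vanish far in the past tend
to zero. -/
theorem tendsto_initial_momentum (hΦ : Φ.WithoutConjugatePoints) {N : ℕ} (hN : 0 < N)
    {r : Fin d → ℤ} (hz : (Φ.lift ^ N) z = (z.1 + intVec r, z.2))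
    (hs : ∀ n, 0 < n → ∀ y, Φ.jacobi (Φ.back z n) (0, W n y) n = (y, s n y)) (y u : Euc d) :
    Tendsto (fun k : ℕ => W ((k + 1) * N) y u) atTop (𝓝 0) := by
  have hback : ∀ k n, (Φ.back z (k * N + n)).1 = (Φ.back z n).1 + intVec (-(k • r)) :=
    fun k n => congrArg Prod.fst (back_mul_add Φ hz k n)
  have hone : ∀ k, Φ.orbit (Φ.back z (k * N)) 1 = Φ.orbit z 1 + intVec (-(k • r)) := by
    intro k
    have h := back_mul_add Φ hz k 0
    rw [add_zero, show Φ.back z 0 = z from rfl] at h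
    rw [h, orbit_add]
  set K := Φ.hess (Φ.back z 1).1 z.1 (0, u) (0, u) +
    Φ.hess z.1 (Φ.orbit z 1) (u, 0) (u, 0) with hK
  have hback0 : (Φ.back z 0) = z := rfl
  have hineq : ∀ k : ℕ, ∀ ε : ℝ, s ((k + 1) * N + 1) y y ≤ s ((k + 1) * N) y y -
      2 * ε * W ((k + 1) * N) y u + ε ^ 2 * K := by
    intro k ε
    have h1 := slope_succ_le hΦ (n := (k + 1) * N) (by positivity) hs y u ε
    have h2 := hback (k + 1) 0
    rw [add_zero, hback0] at h2
    rw [hback, h2, hone, hess_add, hess_add] at h1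
    exact h1
  set K' := |K| + 1 with hK'
  have hK'0 : 0 < K' := by positivity
  have hKK : K ≤ K' := (le_abs_self K).trans (by linarith)
  have hsq : ∀ k : ℕ, W ((k + 1) * N) y u ^ 2 ≤
      K' * (s ((k + 1) * N) y y - s ((k + 1) * N + 1) y y) := by
    intro k
    have h1 := hineq k (W ((k + 1) * N) y u / K')
    set a := W ((k + 1) * N) y u
    have h2 : (a / K') ^ 2 * K ≤ (a / K') ^ 2 * K' := by gcongr
    have h3 : (a / K') ^ 2 * K' = a ^ 2 / K' := by field_simp
    have h4 : 2 * (a / K') * a = 2 * (a ^ 2 / K') := by ring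
    have h5 : a ^ 2 / K' ≤ s ((k + 1) * N) y y - s ((k + 1) * N + 1) y y := by linarith
    rwa [div_le_iff₀' hK'0] at h5
  obtain ⟨l, hl⟩ := exists_tendsto_slope hΦ hs y y
  have hsub : Tendsto (fun k : ℕ => (k + 1) * N) atTop atTop :=
    (tendsto_add_atTop_nat 1).atTop_mul_const' hN
  have h0 : Tendsto (fun k : ℕ => W ((k + 1) * N) y u ^ 2) atTop (𝓝 0) := by
    refine squeeze_zero (fun _ => sq_nonneg _) hsq ?_
    have := ((hl.comp hsub).sub ((hl.comp (tendsto_add_atTop_nat 1)).comp hsub)).const_mul K'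
    simpa using this
  have h1 := h0.sqrt
  simp only [Real.sqrt_sq_eq_abs, Real.sqrt_zero] at h1
  exact (tendsto_zero_iff_abs_tendsto_zero _).2 h1

end Slope

end GeneratingFunction

theorem tendsto_dual_of_forall {d : ℕ} {ι : Type*} {l : Filter ι} {f : ι → EucDual d}
    {g : EucDual d} (h : ∀ u, Tendsto (fun n => f n u) l (𝓝 (g u))) : Tendsto f l (𝓝 g) := by
  have key : ∀ f : EucDual d, f = ∑ i, f (EuclideanSpace.basisFun (Fin d) ℝ i) •
      (EuclideanSpace.proj i : EucDual d) := by
    intro f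
    ext1 u
    conv_lhs => rw [← (EuclideanSpace.basisFun (Fin d) ℝ).sum_repr u]
    rw [map_sum, sum_apply]
    refine Finset.sum_congr rfl fun i _ => ?_
    rw [map_smul, smul_apply, smul_eq_mul, smul_eq_mul, mul_comm]
    rfl
  rw [funext fun n => key (f n), key g]
  exact tendsto_finsetSum _ fun i _ => (h _).smul_const _

namespace GeneratingFunction

variable {d : ℕ} {Φ : GeneratingFunction d} {N : ℕ} {r : Fin d → ℤ} {p : Euc d → EucDual d}

theorem jacobi_tangent (hd : Differentiable ℝ p)
    (hret : ∀ x, (Φ.lift ^ N) (x, p x) = (x + intVec r, p x)) (k : ℕ) (x ξ : Euc d) :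
    Φ.jacobi (x, p x) (ξ, fderiv ℝ p x ξ) (k * N) = (ξ, fderiv ℝ p x ξ) := by
  have h1 : HasFDerivAt (fun x => (x, p x))
      ((ContinuousLinearMap.id ℝ (Euc d)).prod (fderiv ℝ p x)) x :=
    (hasFDerivAt_id x).prodMk (hd x).hasFDerivAt
  have h2 := HasFDerivAt.comp x (Φ.differentiable_lift_pow (k * N) (x, p x)).hasFDerivAt h1
  have h3 : (⇑(Φ.lift ^ (k * N)) ∘ fun x => (x, p x)) = fun x => (x + intVec (k • r), p x) :=
    funext fun x => Φ.lift_pow_mul (hret x) k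
  rw [h3] at h2
  have h4 : HasFDerivAt (fun x => (x + intVec (k • r), p x))
      ((ContinuousLinearMap.id ℝ (Euc d)).prod (fderiv ℝ p x)) x :=
    ((hasFDerivAt_id x).add_const _).prodMk (hd x).hasFDerivAt
  exact DFunLike.congr_fun (h2.unique h4) ξ

theorem tendsto_slope (hΦ : Φ.WithoutConjugatePoints) (hN : 0 < N)
    (hp : ∀ x, Φ.orbit (x, p x) N = x + intVec r) (hd : Differentiable ℝ p) {x : Euc d}
    {s W : ℕ → Euc d →ₗ[ℝ] EucDual d}
    (hs : ∀ n, 0 < n → ∀ y, Φ.jacobi (Φ.back (x, p x) n) (0, W n y) n = (y, s n y)) (y u : Euc d) :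
    Tendsto (fun n => s n y u) atTop (𝓝 (fderiv ℝ p x u y)) := by
  have hret := lift_pow_returnMomentum hΦ hN hp
  have hper := returnMomentum_add hΦ hN hp
  have hfd : ∀ (t : Fin d → ℤ) x, fderiv ℝ p (x + intVec t) = fderiv ℝ p x := by
    intro t x
    rw [← fderiv_comp_add_right]
    simp_rw [hper]
  have hback : ∀ k, Φ.back (x, p x) (k * N) =
      (x + intVec (-(k • r)), p (x + intVec (-(k • r)))) := by
    intro k
    rw [hper]
    exact back_mul_add Φ (hret x) k 0
  have hkey : ∀ k : ℕ, s ((k + 1) * N) y u = fderiv ℝ p x u y + W ((k + 1) * N) y u := by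
    intro k
    have hn : 0 < (k + 1) * N := by positivity
    have h1 := secondVar_slope hn hs y (fun i =>
      (Φ.jacobi (Φ.back (x, p x) ((k + 1) * N)) (u, fderiv ℝ p x u) i).1)
    rw [secondVar_symm, secondVar_jacobi, hs _ hn, jacobi_zero, jacobi_zero] at h1
    have h2 := jacobi_tangent hd hret (k + 1) (x + intVec (-((k + 1) • r))) u
    rw [hfd, ← hback] at h2
    rw [h2, map_zero, sub_zero] at h1
    linarith
  obtain ⟨l, hl⟩ := exists_tendsto_slope hΦ hs y u
  have hsub : Tendsto (fun k : ℕ => (k + 1) * N) atTop atTop :=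
    (tendsto_add_atTop_nat 1).atTop_mul_const' hN
  have h1 := (tendsto_initial_momentum hΦ hN (hret x) hs y u).const_add (fderiv ℝ p x u y)
  rw [add_zero] at h1
  have h2 : l = fderiv ℝ p x u y :=
    tendsto_nhds_unique (hl.comp hsub) (h1.congr fun k => (hkey k).symm)
  rw [← h2]
  exact hl

theorem fderiv_returnMomentum_symm (hΦ : Φ.WithoutConjugatePoints) (hN : 0 < N)
    (hp : ∀ x, Φ.orbit (x, p x) N = x + intVec r) (hd : Differentiable ℝ p) (x y u : Euc d) :
    fderiv ℝ p x u y = fderiv ℝ p x y u := by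
  choose s W hs using fun n => exists_slope hΦ (Φ.back (x, p x) n) n
  refine tendsto_nhds_unique (tendsto_slope hΦ hN hp hd hs y u)
    ((tendsto_slope hΦ hN hp hd hs u y).congr' ?_)
  filter_upwards [eventually_gt_atTop 0] with n hn
  exact (slope_symm hn hs y u).symm

theorem map_zpow_neg_cotMk (n : ℕ) (z : CotEuc d) :
    (Φ.map ^ (-(n : ℤ))) (cotMk z) = cotMk (Φ.back z n) := by
  rw [zpow_neg, zpow_natCast, Equiv.Perm.inv_eq_iff_eq, map_pow_cotMk, lift_pow_back]

/-- The graph of a linear map `ℝ^d → (ℝ^d)^*`. -/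
def linearGraph (s : Euc d →ₗ[ℝ] EucDual d) : Submodule ℝ (CotEuc d) :=
  LinearMap.range (LinearMap.id.prod s)

theorem linearIndependent_graph (s : Euc d →ₗ[ℝ] EucDual d) :
    LinearIndependent ℝ fun i : Fin d => (EuclideanSpace.basisFun (Fin d) ℝ i,
      s (EuclideanSpace.basisFun (Fin d) ℝ i)) := by
  refine LinearIndependent.of_comp (LinearMap.fst ℝ (Euc d) (EucDual d)) ?_
  have h := (EuclideanSpace.basisFun (Fin d) ℝ).toBasis.linearIndependent
  rw [OrthonormalBasis.coe_toBasis] at h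
  exact h

theorem span_graph (s : Euc d →ₗ[ℝ] EucDual d) :
    Submodule.span ℝ (range fun i : Fin d => (EuclideanSpace.basisFun (Fin d) ℝ i,
      s (EuclideanSpace.basisFun (Fin d) ℝ i))) = linearGraph s := by
  have h1 : (fun i : Fin d => (EuclideanSpace.basisFun (Fin d) ℝ i,
      s (EuclideanSpace.basisFun (Fin d) ℝ i))) =
      (LinearMap.id.prod s) ∘ (EuclideanSpace.basisFun (Fin d) ℝ).toBasis := by
    ext1 i
    simp
  rw [h1, range_comp, Submodule.span_image, Module.Basis.span_eq, Submodule.map_top]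
  rfl

theorem isGreenFibre_of_tendsto (hΦ : Φ.WithoutConjugatePoints) {z : CotEuc d}
    {s W : ℕ → Euc d →ₗ[ℝ] EucDual d} {g : Euc d →ₗ[ℝ] EucDual d}
    (hs : ∀ n, 0 < n → ∀ y, Φ.jacobi (Φ.back z n) (0, W n y) n = (y, s n y))
    (hg : ∀ y u, Tendsto (fun n => s n y u) atTop (𝓝 (g y u))) :
    IsGreenFibre Φ.map (cotMk z) (linearGraph g) := by
  let b := EuclideanSpace.basisFun (Fin d) ℝ
  refine ⟨d, fun n i => (b i, s n (b i)), fun i => (b i, g (b i)), ?_,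
    ⟨linearIndependent_graph g, span_graph g⟩, fun i => ?_⟩
  · filter_upwards [eventually_gt_atTop 0] with n hn
    refine ⟨linearIndependent_graph (s n), ?_⟩
    rw [span_graph, map_zpow_neg_cotMk, cotDeriv_map_pow]
    ext v
    constructor
    · rintro ⟨y, rfl⟩
      exact ⟨(0, W n y), mem_verticalSpace.2 rfl, hs n hn y⟩
    · rintro ⟨⟨a, w⟩, hw, rfl⟩
      obtain rfl : a = 0 := mem_verticalSpace.1 hw
      refine ⟨(Φ.jacobi (Φ.back z n) (0, w) n).1, ?_⟩
      have h1 := hs n hn (Φ.jacobi (Φ.back z n) (0, w) n).1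
      have h2 : W n (Φ.jacobi (Φ.back z n) (0, w) n).1 = w := by
        rw [← sub_eq_zero]
        refine hΦ.eq_zero hn (z := Φ.back z n) ?_
        have h3 : ((0 : Euc d), W n (Φ.jacobi (Φ.back z n) (0, w) n).1 - w) =
            (0, W n (Φ.jacobi (Φ.back z n) (0, w) n).1) - (0, w) := by simp
        rw [h3, map_sub]
        change (Φ.jacobi _ _ n).1 - (Φ.jacobi _ _ n).1 = 0
        rw [h1, sub_self]
      rw [h2] at h1
      exact h1.symm
  · exact tendsto_const_nhds.prodMk_nhds (tendsto_dual_of_forall (hg (b i)))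

end GeneratingFunction

end

theorem proposition3p1 {d : ℕ} (hd : 1 ≤ d) (Φ : GeneratingFunction d)
    (hΦ : Φ.WithoutConjugatePoints) (N : ℕ) (hN : 1 ≤ N) (r : Fin d → ℤ) :
    -- it is a graph over the torus, and it is invariant
    (∀ θ : Torus d, ∃! p : EucDual d, (θ, p) ∈ Φ.periodicSet N r) ∧
    Φ.map '' Φ.periodicSet N r = Φ.periodicSet N r ∧
    -- `F^N` is the identity on it
    (∀ ω ∈ Φ.periodicSet N r, (Φ.map ^ N) ω = ω) ∧
    -- it is a Lagrangian submanifold, of class `C^k` if `S` is of class `C^(k+1)`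
    -- (the case `k = 1` always applies)
    (∀ k : ℕ∞, 1 ≤ k → ContDiff ℝ ((k : WithTop ℕ∞) + 1) Φ.S →
      IsLagrangianSubmanifold (k : WithTop ℕ∞) (Φ.periodicSet N r)) ∧
    -- its tangent spaces are the fibres of the Green bundle
    (∀ ω ∈ Φ.periodicSet N r, ∃ G : Submodule ℝ (CotEuc d),
      IsGreenFibre Φ.map ω G ∧ tangentVectors (Φ.periodicSet N r) ω = (G : Set (CotEuc d))) := by
  choose p hp using fun x => Φ.exists_orbit hN x (x + intVec r)
  have hdiff : Differentiable ℝ p :=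
    (GeneratingFunction.contDiff_returnMomentum hΦ hN hp le_rfl
      Φ.contDiff_one_lift).differentiable (by norm_num)
  have hL := GeneratingFunction.cotMk_mem_periodicSet_iff hΦ hN hp
  have hrep : ∀ ω ∈ Φ.periodicSet N r, ∃ x, ω = cotMk (x, p x) := by
    rintro _ ⟨z, hz, rfl⟩
    refine ⟨z.1, ?_⟩
    rw [← (hL z).1 ⟨z, hz, rfl⟩]
  have hT := fun x => tangentVectors_eq_of_graph hdiff hL x
  have hadd : ∀ z : CotEuc d, Φ.lift (z.1 + intVec r, z.2) =
      ((Φ.lift z).1 + intVec r, (Φ.lift z).2) := fun z => Φ.lift_add r z.1 z.2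
  refine ⟨fun θ => ?_, ?_, ?_, fun k hk hS => ⟨?_, ?_⟩, ?_⟩
  · have h1 : ∀ q, (θ, q) = cotMk (θ.out, q) := fun q =>
      Prod.ext (torusMk_out θ).symm rfl
    refine ⟨p θ.out, ?_, fun q hq => ?_⟩
    · beta_reduce
      rw [h1, hL]
    · beta_reduce at hq
      rw [h1, hL] at hq
      exact hq
  · have hcomm : ∀ z : CotEuc d, (Φ.lift ^ N) (Φ.lift z) = Φ.lift ((Φ.lift ^ N) z) := fun z => by
      rw [← Equiv.Perm.mul_apply, ← Equiv.Perm.mul_apply, ← pow_succ, pow_succ']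
    refine Subset.antisymm ?_ ?_
    · rintro _ ⟨_, ⟨z, hz, rfl⟩, rfl⟩
      refine ⟨Φ.lift z, ?_, (Φ.map_cotMk z).symm⟩
      change (Φ.lift ^ N) (Φ.lift z) = _
      rw [hcomm, show (Φ.lift ^ N) z = _ from hz, hadd]
    · rintro _ ⟨z, hz, rfl⟩
      refine ⟨cotMk (Φ.lift.symm z), ⟨Φ.lift.symm z, ?_, rfl⟩, ?_⟩
      · refine Φ.lift.injective ?_
        rw [← hcomm, hadd, Equiv.apply_symm_apply]
        exact hz
      · rw [Φ.map_cotMk, Equiv.apply_symm_apply]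
  · rintro _ ⟨z, hz, rfl⟩
    rw [Φ.map_pow_cotMk, show (Φ.lift ^ N) z = _ from hz]
    exact Prod.ext (torusMk_add z.1 r) rfl
  · have hk' : (1 : WithTop ℕ∞) ≤ k := by exact_mod_cast hk
    exact isSubmanifold_of_graph (GeneratingFunction.contDiff_returnMomentum hΦ hN hp hk'
      (Φ.contDiff_lift hk' hS)) hL
  · intro ω hω v hv w hw
    obtain ⟨x, rfl⟩ := hrep ω hω
    rw [hT] at hv hw
    have hv' : v.2 = fderiv ℝ p x v.1 := hv
    have hw' : w.2 = fderiv ℝ p x w.1 := hw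
    rw [canonicalForm, hv', hw', sub_eq_zero]
    exact GeneratingFunction.fderiv_returnMomentum_symm hΦ hN hp hdiff x w.1 v.1
  · intro ω hω
    obtain ⟨x, rfl⟩ := hrep ω hω
    choose s W hs using fun n => GeneratingFunction.exists_slope hΦ (Φ.back (x, p x) n) n
    refine ⟨GeneratingFunction.linearGraph (fderiv ℝ p x).toLinearMap,
      GeneratingFunction.isGreenFibre_of_tendsto hΦ hs fun y u => ?_, ?_⟩
    · have := GeneratingFunction.tendsto_slope hΦ hN hp hdiff hs y u
      rwa [GeneratingFunction.fderiv_returnMomentum_symm hΦ hN hp hdiff] at this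
    · rw [hT]
      ext v
      constructor
      · intro hv
        exact ⟨v.1, Prod.ext rfl (show v.2 = _ from hv).symm⟩
      · rintro ⟨y, rfl⟩
        rfl
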